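/- Let $a,b$ be integers with $1\le a<b$. In the two-dimensional $(a,b)$ bootstrap model, the neighborhood of a site $(x,y)\in\mathbb Z^2$ consists of the $2(a+b)$ sites $(x+i,y)$ with $1\le|i|\le a$ and $(x,y+j)$ with $1\le|j|\le b$. For an integer $L\ge 0$, let initially every site of the square $[0,L]^2\subset\mathbb Z^2$ be occupied with probability $p\in(0,1)$, independently of all other sites (sites outside the square are never occupied). Repeatedly, every site of the square that has at least $a+b$ occupied sites in its neighborhood becomes occupied, and occupied sites remain occupied. The square is internally spanned if in the final configuration all its sites are occupied; let $\mathbb P_p([0,L]^2\text{ i.s.})$ denote the probability of this event. Then there are constants $0<\gamma_{a,b}<\Gamma_{a,b}$, depending only on $a$ and $b$, such that for every function $p\mapsto L(p)\in\{0,1,2,\dots\}$, as $p\to0^+$, $$\mathbb P_p([0,L(p)]^2\text{ i.s.})\to 0\quad\text{if } L(p)<\exp\left(\gamma_{a,b}\,p^{-a}\ln^2 p\right)\text{ for all sufficiently small } p>0,$$ $$\mathbb P_p([0,L(p)]^2\text{ i.s.})\to 1\quad\text{if } L(p)>\exp\left(\Gamma_{a,b}\,p^{-a}\ln^2 p\right)\text{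 for all sufficiently small } p>0.$$ -/

import Mathlib

open Filter Topology ProbabilityTheory MeasureTheory

namespace AnisotropicBootstrap

/-- The neighborhood of the site `v` in the `(a,b)` model: the sites other than `v` on the same
horizontal line at distance at most `a`, and those on the same vertical line at distance at
most `b`. It consists of `2 * (a + b)` sites. -/
def neighborhood (a b : ℕ) (v : ℤ × ℤ) : Set (ℤ × ℤ) :=
  {w | w ≠ v ∧ ((w.2 = v.2 ∧ |w.1 - v.1| ≤ (a : ℤ)) ∨ (w.1 = v.1 ∧ |w.2 - v.2| ≤ (b : ℤ)))}

theorem neighborhood_finite (a b : ℕ) (v : ℤ × ℤ) : (neighborhood a b v).Finite := by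
  refine (Set.finite_Icc (v.1 - a - b, v.2 - a - b) (v.1 + a + b, v.2 + a + b)).subset ?_
  rintro ⟨x, y⟩ ⟨-, h⟩
  simp only [abs_le] at h
  simp only [Set.mem_Icc, Prod.mk_le_mk]
  omega

/-- One application of the bootstrap rule in the region `D`: occupied sites remain occupied, and
a site of `D` becomes occupied if at least `a + b` sites of its neighborhood (half of it) are
occupied. -/
def step (a b : ℕ) (D A : Set (ℤ × ℤ)) : Set (ℤ × ℤ) :=
  A ∪ {v | v ∈ D ∧ a + b ≤ (neighborhood a b v ∩ A).ncard}

/-- The final configuration in `D` started from `A`: all sites that are occupied after some number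
of applications of the rule. -/
def finalConfig (a b : ℕ) (D A : Set (ℤ × ℤ)) : Set (ℤ × ℤ) :=
  ⋃ n : ℕ, (step a b D)^[n] A

/-- The region `D` is internally spanned by the occupied sites of `A` that lie in `D`. -/
def InternallySpanned (a b : ℕ) (D A : Set (ℤ × ℤ)) : Prop :=
  finalConfig a b D (A ∩ D) = D

/-- The sites of the square `[0,L]²`. -/
def square (L : ℕ) : Set (ℤ × ℤ) :=
  Set.Icc 0 (L : ℤ) ×ˢ Set.Icc 0 (L : ℤ)

/-- The probability that `[0,L]²` is internally spanned in the `(a,b)` model, if initially each of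
its sites is occupied with probability `p`, independently of all others. -/
noncomputable def spanProb (a b L : ℕ) (p : unitInterval) : ℝ :=
  (setBernoulli (square L) p).real {A | InternallySpanned a b (square L) A}

end AnisotropicBootstrap

/-! Write p = exp(-t) and Z = p^(-a) = exp(a t), so that both thresholds have the form exp(const · Z
t²). Growth is anisotropic. A row on top of a full region already has b occupied neighbours per site
below it and needs a run of a occupied sites to fill. A column next to a full region needs a run of
b > a sites. Hence droplets grow easily upwards and with difficulty sideways, and the critical
droplet has width of order Z t.

Lower threshold. If the square is spanned, an Aizenman–Lebowitz argument
(`exists_droplet_of_spanned`) gives a connected set, spanned inside its own bounding rectangle, that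
has width at least k or height at least h but at most about twice these sizes. Here k is about c Z t
and h about p^(-a-1/2). The rectangle is cut into strips of bounded width. A site of a vertical
strip sees at most a sites outside it, so a strip without b nearby occupied sites is never changed
by the dynamics; the connected set crossing it must then consist of initially occupied sites there,
which is again such a cluster (`exists_cluster_of_traversed`). Horizontal strips need a nearby sites
in the same way. In a wide rectangle each vertical strip has a cluster with probability O(h p^b) ≤
p^(1/4), and there are about k of them: together exp(-const · Z t²). In a tall one each horizontal
strip fails with probability at least p^(1/4), because its width is only O(c Z t), and there are
p^(-a-1/2) strips, which costs even more. The (L+1)^4 choices of the rectangle are absorbed when γ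
is small (`bprob_spanned_le`).

Upper threshold. A full rectangle of width w, about a(b+2) Z t, and height b has probability p^(wb)
= exp(-O(Z t²)). With probability at least 1/2 it grows up to height p^(-b-1), then sideways, then
as a square (`Stable.rect_subset`). Along the bottom of [0,L]² there are about √L disjoint boxes of
side about √L, so some box contains a successful seed; runs in all segments of length about √L then
carry the full box to the whole square (`square_subset_of_lines`).

Probabilities are computed as finite sums over subsets, with independence on disjoint sets, union
bounds and Harris' inequality. -/

namespace AnisotropicBootstrap

/-! ### Finite product Bernoulli measures: independence, union bounds, Harris' inequality. -/

section Bernoulli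

variable {α ι : Type*} [DecidableEq α]

/-- The expectation of `f S`, where `S` contains each element of `F` independently with
probability `p`. -/
noncomputable def bexp (p : ℝ) (F : Finset α) (f : Finset α → ℝ) : ℝ :=
  ∑ S ∈ F.powerset, p ^ S.card * (1 - p) ^ (F \ S).card * f S

/-- The probability of the event `E` for a random subset that contains each element of `F`
independently with probability `p`. -/
noncomputable def bprob (p : ℝ) (F : Finset α) (E : Set (Finset α)) : ℝ :=
  bexp p F (E.indicator 1)

theorem bexp_empty (p : ℝ) (f : Finset α → ℝ) : bexp p ∅ f = f ∅ := by
  simp [bexp]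

/-- Conditioning on the single site `x`; the product structure is exploited through this recursion.
-/
theorem bexp_insert (p : ℝ) {x : α} {F : Finset α} (hx : x ∉ F) (f : Finset α → ℝ) :
    bexp p (insert x F) f = (1 - p) * bexp p F f + p * bexp p F (fun S => f (insert x S)) := by
  unfold bexp
  rw [Finset.sum_powerset_insert hx, Finset.mul_sum, Finset.mul_sum]
  congr 1
  · refine Finset.sum_congr rfl fun S hS => ?_
    have hxS : x ∉ S := fun h => hx (Finset.mem_powerset.1 hS h)
    have : insert x F \ S = insert x (F \ S) := Finset.insert_sdiff_of_notMem _ hxS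
    rw [this, Finset.card_insert_of_notMem (by simp [hx]), pow_succ]
    ring
  · refine Finset.sum_congr rfl fun S hS => ?_
    have hxS : x ∉ S := fun h => hx (Finset.mem_powerset.1 hS h)
    have : insert x F \ insert x S = F \ S := by
      ext y
      simp only [Finset.mem_sdiff, Finset.mem_insert]
      constructor
      · rintro ⟨h | h, h'⟩ <;> simp_all
      · rintro ⟨h, h'⟩
        exact ⟨Or.inr h, by rintro (rfl | h2) <;> contradiction⟩
    rw [this, Finset.card_insert_of_notMem hxS, pow_succ]
    ring

theorem bexp_mono {p : ℝ} (hp0 : 0 ≤ p) (hp1 : p ≤ 1) {F : Finset α} {f g : Finset α → ℝ}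
    (h : ∀ S ⊆ F, f S ≤ g S) : bexp p F f ≤ bexp p F g := by
  refine Finset.sum_le_sum fun S hS => ?_
  have : 0 ≤ 1 - p := by linarith
  exact mul_le_mul_of_nonneg_left (h S (Finset.mem_powerset.1 hS)) (by positivity)

theorem bexp_congr {p : ℝ} {F : Finset α} {f g : Finset α → ℝ}
    (h : ∀ S ⊆ F, f S = g S) : bexp p F f = bexp p F g :=
  Finset.sum_congr rfl fun S hS => by rw [h S (Finset.mem_powerset.1 hS)]

theorem bexp_const (p : ℝ) (F : Finset α) (c : ℝ) : bexp p F (fun _ => c) = c := by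
  induction F using Finset.induction_on with
  | empty => simp [bexp_empty]
  | insert x F hx ih => rw [bexp_insert p hx, ih]; ring

theorem bexp_add (p : ℝ) (F : Finset α) (f g : Finset α → ℝ) :
    bexp p F (fun S => f S + g S) = bexp p F f + bexp p F g := by
  simp [bexp, mul_add, Finset.sum_add_distrib]

theorem bexp_mul_left (p : ℝ) (F : Finset α) (c : ℝ) (f : Finset α → ℝ) :
    bexp p F (fun S => c * f S) = c * bexp p F f := by
  simp only [bexp, Finset.mul_sum]
  exact Finset.sum_congr rfl fun S _ => by ring

theorem bexp_sum (p : ℝ) (F : Finset α) (I : Finset ι) (f : ι → Finset α → ℝ) :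
    bexp p F (fun S => ∑ i ∈ I, f i S) = ∑ i ∈ I, bexp p F (f i) := by
  simp only [bexp, Finset.mul_sum]
  exact Finset.sum_comm

theorem bexp_union (p : ℝ) {F G : Finset α} (h : Disjoint F G) (f : Finset α → ℝ) :
    bexp p (F ∪ G) f = bexp p F (fun S => bexp p G (fun T => f (S ∪ T))) := by
  induction F using Finset.induction_on generalizing f with
  | empty => simp [bexp_empty]
  | insert x F hx ih =>
    rw [Finset.disjoint_insert_left] at h
    rw [Finset.insert_union, bexp_insert p (by simp [hx, h.1]), bexp_insert p hx, ih h.2, ih h.2]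
    simp only [Finset.insert_union]

theorem bexp_mul_of_disjoint (p : ℝ) {F G H : Finset α} (hGH : Disjoint G H) (hG : G ⊆ F)
    (hH : H ⊆ F) (f g : Finset α → ℝ) :
    bexp p F (fun S => f (S ∩ G) * g (S ∩ H)) = bexp p G f * bexp p H g := by
  have key : ∀ {F G : Finset α}, G ⊆ F → ∀ f : Finset α → ℝ,
      bexp p F (fun S => f (S ∩ G)) = bexp p G f := by
    intro F G hGF f
    have hd : Disjoint G (F \ G) := Finset.disjoint_sdiff
    rw [← Finset.union_sdiff_of_subset hGF, bexp_union p hd]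
    refine bexp_congr fun S hS => ?_
    rw [← bexp_const p (F \ G) (f S)]
    refine bexp_congr fun T hT => ?_
    congr 1
    rw [Finset.union_inter_distrib_right, Finset.inter_eq_left.2 hS,
      Finset.disjoint_iff_inter_eq_empty.1 (hd.symm.mono_left hT), Finset.union_empty]
  have hFG : G ∪ H ⊆ F := Finset.union_subset hG hH
  rw [← key hG, ← key hH]
  have h1 : bexp p F (fun S => f (S ∩ G) * g (S ∩ H)) =
      bexp p (G ∪ H) (fun S => f (S ∩ G) * g (S ∩ H)) := by
    rw [← key hFG]
    refine bexp_congr fun S _ => ?_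
    rw [Finset.inter_assoc, Finset.inter_assoc, Finset.inter_eq_right.2 Finset.subset_union_left,
      Finset.inter_eq_right.2 Finset.subset_union_right]
  rw [h1, bexp_union p hGH, key hG, key hH, mul_comm, ← bexp_mul_left]
  refine bexp_congr fun S hS => ?_
  rw [mul_comm, ← bexp_mul_left]
  refine bexp_congr fun T hT => ?_
  have e1 : (S ∪ T) ∩ G = S := by
    rw [Finset.union_inter_distrib_right, Finset.inter_eq_left.2 hS,
      Finset.disjoint_iff_inter_eq_empty.1 (hGH.symm.mono_left hT), Finset.union_empty]
  have e2 : (S ∪ T) ∩ H = T := by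
    rw [Finset.union_inter_distrib_right, Finset.inter_eq_left.2 hT,
      Finset.disjoint_iff_inter_eq_empty.1 (hGH.mono_left hS), Finset.empty_union]
  rw [e1, e2]

theorem bexp_inter (p : ℝ) {F G : Finset α} (hG : G ⊆ F) (f : Finset α → ℝ) :
    bexp p F (fun S => f (S ∩ G)) = bexp p G f := by
  have := bexp_mul_of_disjoint p (Finset.disjoint_empty_right G) hG (Finset.empty_subset F) f
    (fun _ => 1)
  simpa [bexp_const] using this

/-- **Harris' inequality**, for two increasing functions. -/
theorem bexp_mul_le_of_monotone {p : ℝ} (hp0 : 0 ≤ p) (hp1 : p ≤ 1) (F : Finset α)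
    {f g : Finset α → ℝ} (hf : Monotone f) (hg : Monotone g) :
    bexp p F f * bexp p F g ≤ bexp p F (fun S => f S * g S) := by
  induction F using Finset.induction_on generalizing f g with
  | empty => simp [bexp_empty]
  | insert x F hx ih =>
    have hf' : Monotone fun S => f (insert x S) := fun S T h => hf (Finset.insert_subset_insert x h)
    have hg' : Monotone fun S => g (insert x S) := fun S T h => hg (Finset.insert_subset_insert x h)
    have h1 := ih hf hg
    have h2 := ih hf' hg'
    have h3 : bexp p F f ≤ bexp p F (fun S => f (insert x S)) :=
      bexp_mono hp0 hp1 fun S _ => hf (Finset.subset_insert x S)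
    have h4 : bexp p F g ≤ bexp p F (fun S => g (insert x S)) :=
      bexp_mono hp0 hp1 fun S _ => hg (Finset.subset_insert x S)
    rw [bexp_insert p hx, bexp_insert p hx, bexp_insert p hx]
    -- Conditioning on `x` leaves the covariance of a two-point variable, p(1-p)(f₁-f₀)(g₁-g₀),
    -- whose two increments are nonnegative by monotonicity; `h7` and `h8` are the covariances
    -- inside the two branches.
    have h5 : 0 ≤ p * (1 - p) := mul_nonneg hp0 (by linarith)
    have h6 := mul_nonneg h5 (mul_nonneg (sub_nonneg.2 h3) (sub_nonneg.2 h4))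
    have h7 := mul_le_mul_of_nonneg_left h1 (sub_nonneg.2 hp1)
    have h8 := mul_le_mul_of_nonneg_left h2 hp0
    nlinarith

theorem bprob_mono {p : ℝ} (hp0 : 0 ≤ p) (hp1 : p ≤ 1) {F : Finset α} {E E' : Set (Finset α)}
    (h : ∀ S ⊆ F, S ∈ E → S ∈ E') : bprob p F E ≤ bprob p F E' := by
  classical
  refine bexp_mono hp0 hp1 fun S hS => ?_
  simp only [Set.indicator_apply, Pi.one_apply]
  split_ifs with h1 h2
  · rfl
  · exact absurd (h S hS h1) h2
  · exact zero_le_one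
  · rfl

theorem bprob_nonneg {p : ℝ} (hp0 : 0 ≤ p) (hp1 : p ≤ 1) (F : Finset α) (E : Set (Finset α)) :
    0 ≤ bprob p F E := by
  rw [← bexp_const p F 0]
  exact bexp_mono hp0 hp1 fun S _ => Set.indicator_nonneg (fun _ _ => zero_le_one) S

theorem bprob_compl (p : ℝ) (F : Finset α) (E : Set (Finset α)) :
    bprob p F Eᶜ = 1 - bprob p F E := by
  rw [eq_sub_iff_add_eq, bprob, bprob, ← bexp_add, ← bexp_const p F 1]
  refine bexp_congr fun S _ => ?_
  by_cases h : S ∈ E <;> simp [h]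

theorem bprob_le_sum {p : ℝ} (hp0 : 0 ≤ p) (hp1 : p ≤ 1) {F : Finset α} {E : Set (Finset α)}
    (I : Finset ι) (E' : ι → Set (Finset α)) (h : ∀ S ⊆ F, S ∈ E → ∃ i ∈ I, S ∈ E' i) :
    bprob p F E ≤ ∑ i ∈ I, bprob p F (E' i) := by
  classical
  unfold bprob
  rw [← bexp_sum]
  refine bexp_mono hp0 hp1 fun S hS => ?_
  by_cases hE : S ∈ E
  · obtain ⟨i, hi, hS'⟩ := h S hS hE
    have h1 : (E' i).indicator (1 : Finset α → ℝ) S = 1 := by simp [hS']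
    rw [Set.indicator_of_mem hE, Pi.one_apply, ← h1]
    exact Finset.single_le_sum (f := fun i => (E' i).indicator (1 : Finset α → ℝ) S)
      (fun j _ => Set.indicator_nonneg (fun _ _ => zero_le_one) S) hi
  · rw [Set.indicator_of_notMem hE]
    exact Finset.sum_nonneg fun j _ => Set.indicator_nonneg (fun _ _ => zero_le_one) S

theorem bprob_le_add {p : ℝ} (hp0 : 0 ≤ p) (hp1 : p ≤ 1) {F : Finset α} {E E₁ E₂ : Set (Finset α)}
    (h : ∀ S ⊆ F, S ∈ E → S ∈ E₁ ∨ S ∈ E₂) :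
    bprob p F E ≤ bprob p F E₁ + bprob p F E₂ := by
  have := bprob_le_sum hp0 hp1 (F := F) (E := E) Finset.univ (fun i : Bool => cond i E₁ E₂)
    (fun S hS hE => by
      rcases h S hS hE with h | h
      · exact ⟨true, by simp, h⟩
      · exact ⟨false, by simp, h⟩)
  simpa using this

theorem bprob_superset (p : ℝ) {F T : Finset α} (hT : T ⊆ F) :
    bprob p F {S | T ⊆ S} = p ^ T.card := by
  have h1 : bprob p F {S | T ⊆ S} = bexp p T ({S | T ⊆ S}.indicator 1) := by
    rw [bprob, ← bexp_inter p hT]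
    refine bexp_congr fun S _ => ?_
    by_cases h : T ⊆ S <;> simp [h, Finset.subset_inter_iff]
  rw [h1, bexp, Finset.sum_eq_single T]
  · simp
  · intro S hS hne
    have : ¬ T ⊆ S := fun h => hne (Finset.Subset.antisymm (Finset.mem_powerset.1 hS) h)
    simp [this]
  · simp

/-- Events that depend on disjoint sets of sites are independent. -/
theorem bprob_forall_of_pairwiseDisjoint [DecidableEq ι] (p : ℝ) {F : Finset α} (I : Finset ι)
    (G : ι → Finset α) (hG : ∀ i ∈ I, G i ⊆ F) (hd : (I : Set ι).PairwiseDisjoint G)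
    (E : ι → Set (Finset α)) :
    bprob p F {S | ∀ i ∈ I, S ∩ G i ∈ E i} = ∏ i ∈ I, bprob p (G i) (E i) := by
  induction I using Finset.induction_on with
  | empty =>
    have : {S : Finset α | ∀ i ∈ (∅ : Finset ι), S ∩ G i ∈ E i} = Set.univ := by ext; simp
    rw [this, bprob, Finset.prod_empty, ← bexp_const p F 1]
    exact bexp_congr fun S _ => by simp
  | insert j I hj ih =>
    rw [Finset.prod_insert hj, ← ih (fun i hi => hG i (Finset.mem_insert_of_mem hi))
      (hd.subset (by simp))]
    set H := I.biUnion G with hH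
    have hHF : H ⊆ F := Finset.biUnion_subset.2 fun i hi => hG i (Finset.mem_insert_of_mem hi)
    have hjF := hG j (Finset.mem_insert_self _ _)
    have hdis : Disjoint (G j) H := by
      rw [hH, Finset.disjoint_biUnion_right]
      intro i hi
      exact hd (by simp) (by simp [hi]) (fun h => hj (h ▸ hi))
    have hin : ∀ S : Finset α, ∀ i ∈ I, S ∩ H ∩ G i = S ∩ G i := fun S i hi => by
      rw [Finset.inter_assoc, Finset.inter_eq_right.2 (Finset.subset_biUnion_of_mem G hi)]
    have e1 : bprob p F {S | ∀ i ∈ I, S ∩ G i ∈ E i} = bprob p H {S | ∀ i ∈ I, S ∩ G i ∈ E i} := by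
      rw [bprob, bprob, ← bexp_inter p hHF]
      refine bexp_congr fun S _ => ?_
      have : (S ∩ H ∈ {S | ∀ i ∈ I, S ∩ G i ∈ E i}) ↔ S ∈ {S | ∀ i ∈ I, S ∩ G i ∈ E i} := by
        simp only [Set.mem_ofPred_eq]
        exact forall₂_congr fun i hi => by rw [hin S i hi]
      by_cases h : S ∈ {S | ∀ i ∈ I, S ∩ G i ∈ E i}
      · rw [Set.indicator_of_mem h, Set.indicator_of_mem (this.2 h)]; rfl
      · rw [Set.indicator_of_notMem h, Set.indicator_of_notMem (fun h' => h (this.1 h'))]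
    rw [e1]
    unfold bprob
    rw [← bexp_mul_of_disjoint p hdis hjF hHF]
    refine bexp_congr fun S _ => ?_
    have : (S ∈ {S | ∀ i ∈ insert j I, S ∩ G i ∈ E i}) ↔
        S ∩ G j ∈ E j ∧ S ∩ H ∈ {S | ∀ i ∈ I, S ∩ G i ∈ E i} := by
      simp only [Set.mem_ofPred_eq, Finset.forall_mem_insert]
      exact and_congr_right fun _ => forall₂_congr fun i hi => by rw [hin S i hi]
    classical
    simp only [Set.indicator_apply, this, Pi.one_apply, mul_ite, mul_one, mul_zero]
    by_cases h1 : S ∩ G j ∈ E j <;>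
      by_cases h2 : S ∩ H ∈ {S | ∀ i ∈ I, S ∩ G i ∈ E i} <;> simp only [h1, h2] <;> simp

theorem bprob_mul_le_of_isUpperSet {p : ℝ} (hp0 : 0 ≤ p) (hp1 : p ≤ 1) (F : Finset α)
    {E E' : Set (Finset α)} (hE : IsUpperSet E) (hE' : IsUpperSet E') :
    bprob p F E * bprob p F E' ≤ bprob p F (E ∩ E') := by
  classical
  have hmon : ∀ {E : Set (Finset α)}, IsUpperSet E → Monotone (E.indicator (1 : Finset α → ℝ)) := by
    intro E hE S T hST
    by_cases h : S ∈ E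
    · rw [Set.indicator_of_mem h, Set.indicator_of_mem (hE hST h)]; rfl
    · rw [Set.indicator_of_notMem h]
      exact Set.indicator_nonneg (fun _ _ => zero_le_one) T
  refine (bexp_mul_le_of_monotone hp0 hp1 F (hmon hE) (hmon hE')).trans (le_of_eq ?_)
  refine bexp_congr fun S _ => ?_
  by_cases h1 : S ∈ E <;> by_cases h2 : S ∈ E' <;> simp [h1, h2]

/-- Passing to complements does not change the covariance of two events, so this is the case of
upper sets combined with inclusion–exclusion. -/
theorem bprob_mul_le_of_isLowerSet {p : ℝ} (hp0 : 0 ≤ p) (hp1 : p ≤ 1) (F : Finset α)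
    {E E' : Set (Finset α)} (hE : IsLowerSet E) (hE' : IsLowerSet E') :
    bprob p F E * bprob p F E' ≤ bprob p F (E ∩ E') := by
  have h := bprob_mul_le_of_isUpperSet hp0 hp1 F hE.compl hE'.compl
  have h1 : bprob p F (E ∪ E') + bprob p F (E ∩ E') = bprob p F E + bprob p F E' := by
    unfold bprob
    rw [← bexp_add, ← bexp_add]
    refine bexp_congr fun S _ => ?_
    by_cases h1 : S ∈ E <;> by_cases h2 : S ∈ E' <;> simp [h1, h2]
  rw [← Set.compl_union, bprob_compl, bprob_compl, bprob_compl] at h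
  linarith

theorem prod_bprob_le_of_isLowerSet [DecidableEq ι] {p : ℝ} (hp0 : 0 ≤ p) (hp1 : p ≤ 1)
    (F : Finset α) (I : Finset ι) (E : ι → Set (Finset α)) (hE : ∀ i ∈ I, IsLowerSet (E i)) :
    ∏ i ∈ I, bprob p F (E i) ≤ bprob p F {S | ∀ i ∈ I, S ∈ E i} := by
  induction I using Finset.induction_on with
  | empty =>
    have : {S : Finset α | ∀ i ∈ (∅ : Finset ι), S ∈ E i} = (∅ : Set (Finset α))ᶜ := by ext; simp
    rw [this, bprob_compl, bprob, Finset.prod_empty, Set.indicator_empty]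
    simp [bexp_const]
  | insert j I hj ih =>
    rw [Finset.prod_insert hj]
    have hI : ∀ i ∈ I, IsLowerSet (E i) := fun i hi => hE i (Finset.mem_insert_of_mem hi)
    have hl : IsLowerSet {S | ∀ i ∈ I, S ∈ E i} := fun S T hTS h i hi => hI i hi hTS (h i hi)
    refine (mul_le_mul_of_nonneg_left (ih hI) (bprob_nonneg hp0 hp1 F _)).trans ?_
    refine (bprob_mul_le_of_isLowerSet hp0 hp1 F (hE j (Finset.mem_insert_self _ _)) hl).trans ?_
    exact bprob_mono hp0 hp1 fun S _ h => Finset.forall_mem_insert _ _ _ |>.2 ⟨h.1, h.2⟩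

/-- The bridge from the product measure to finite sums: only subsets of `F` carry mass, and each is
an atom of known weight. -/
theorem setBernoulli_real_eq_bprob [Countable α] (F : Finset α) (p : unitInterval)
    (E : Set (Set α)) :
    (setBernoulli (F : Set α) p).real E = bprob (p : ℝ) F {S | (S : Set α) ∈ E} := by
  classical
  rw [measureReal_def, setBernoulli_apply_eq_apply_subsets, ← measureReal_def]
  have h1 : {s | s ∈ E ∧ s ⊆ (F : Set α)} =
      ⋃ S ∈ F.powerset.filter (fun S : Finset α => (S : Set α) ∈ E), {(S : Set α)} := by
    ext s
    simp only [Set.mem_ofPred_eq, Finset.mem_filter, Finset.mem_powerset, Set.mem_iUnion,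
      Set.mem_singleton_iff, exists_prop]
    constructor
    · rintro ⟨hs, hF⟩
      lift s to Finset α using F.finite_toSet.subset hF
      exact ⟨s, ⟨by exact_mod_cast hF, hs⟩, rfl⟩
    · rintro ⟨S, ⟨hS, hE⟩, rfl⟩
      exact ⟨hE, by exact_mod_cast hS⟩
  rw [h1, measureReal_biUnion_finset]
  · rw [Finset.sum_filter, bprob, bexp]
    refine Finset.sum_congr rfl fun S hS => ?_
    have hS' : (S : Set α) ⊆ F := by exact_mod_cast Finset.mem_powerset.1 hS
    rw [setBernoulli_real_singleton p hS' F.finite_toSet, Set.ncard_coe_finset,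
      ← Finset.coe_sdiff, Set.ncard_coe_finset]
    by_cases h : (S : Set α) ∈ E <;> simp [h]
  · intro S _ T _ hST
    simpa [Function.onFun] using hST
  · intro S _
    have : ((S : Set α)).Finite := S.finite_toSet
    -- A singleton is a countable intersection of one-site events, hence measurable.
    have : {(S : Set α)} = ⋂ x : α, {s : Set α | x ∈ s ↔ x ∈ S} := by
      ext s; simp [Set.ext_iff]
    rw [this]
    refine MeasurableSet.iInter fun x => ?_
    by_cases hx : x ∈ S
    · simpa [hx] using measurableSet_setOfPred.2 (measurable_set_mem x)
    · simpa [hx] using measurableSet_setOfPred.2 (measurable_set_notMem x)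

end Bernoulli

/-! ### Deterministic bounds on the dynamics: stable supersets, linked sets, strips. -/

section Dynamics

variable {a b : ℕ}

theorem subset_finalConfig (D A : Set (ℤ × ℤ)) : A ⊆ finalConfig a b D A :=
  Set.subset_iUnion (fun n => (step a b D)^[n] A) 0

theorem iterate_step_monotone (D A : Set (ℤ × ℤ)) : Monotone fun n => (step a b D)^[n] A := by
  refine monotone_nat_of_le_succ fun n => ?_
  rw [Function.iterate_succ_apply']
  exact Set.subset_union_left

/-- Neighbourhoods are finite and the iterates increase, so all occupied neighbours are present at
one finite time and the rule applies at the next. -/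
theorem mem_finalConfig_of_le {D A : Set (ℤ × ℤ)} {v : ℤ × ℤ} (hv : v ∈ D)
    (h : a + b ≤ (neighborhood a b v ∩ finalConfig a b D A).ncard) :
    v ∈ finalConfig a b D A := by
  have hfin : (neighborhood a b v ∩ finalConfig a b D A).Finite :=
    (neighborhood_finite a b v).subset Set.inter_subset_left
  have hsub : neighborhood a b v ∩ finalConfig a b D A ⊆ ⋃ n, (step a b D)^[n] A :=
    Set.inter_subset_right
  rw [← hfin.coe_toFinset] at hsub
  obtain ⟨n, hn⟩ := (iterate_step_monotone (a := a) (b := b) D A).directed_le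
    |>.exists_mem_subset_of_finset_subset_biUnion hsub
  rw [hfin.coe_toFinset] at hn
  refine Set.mem_iUnion.2 ⟨n + 1, ?_⟩
  rw [Function.iterate_succ_apply']
  refine Or.inr ⟨hv, h.trans (Set.ncard_le_ncard ?_
    ((neighborhood_finite a b v).subset Set.inter_subset_left))⟩
  exact fun w hw => ⟨hw.1, hn hw⟩

/-- The final configuration is the least stable superset of `A`; exhibiting a stable `U` is how the
dynamics is bounded from above. -/
theorem finalConfig_subset {D A U : Set (ℤ × ℤ)} (hA : A ⊆ U)
    (hU : ∀ v ∈ D, a + b ≤ (neighborhood a b v ∩ U).ncard → v ∈ U) :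
    finalConfig a b D A ⊆ U := by
  refine Set.iUnion_subset fun n => ?_
  induction n with
  | zero => simpa using hA
  | succ n ih =>
    rw [Function.iterate_succ_apply']
    rintro v (hv | ⟨hv, h⟩)
    · exact ih hv
    · exact hU v hv (h.trans (Set.ncard_le_ncard (Set.inter_subset_inter_right _ ih)
        ((neighborhood_finite a b v).subset Set.inter_subset_left)))

/-- The sites `u` and `v` have `ℓ^∞`-distance at most `d`. -/
def Near (d : ℕ) (u v : ℤ × ℤ) : Prop := |u.1 - v.1| ≤ (d : ℤ) ∧ |u.2 - v.2| ≤ (d : ℤ)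

theorem Near.symm {d : ℕ} {u v : ℤ × ℤ} (h : Near d u v) : Near d v u := by
  unfold Near at *
  rwa [abs_sub_comm v.1, abs_sub_comm v.2]

theorem near_refl (d : ℕ) (u : ℤ × ℤ) : Near d u u := by simp [Near]

theorem Near.trans {d e : ℕ} {u v w : ℤ × ℤ} (h : Near d u v) (h' : Near e v w) :
    Near (d + e) u w := by
  unfold Near at *
  simp only [abs_le] at *
  push_cast
  omega

theorem Near.mono {d e : ℕ} (hde : d ≤ e) {u v : ℤ × ℤ} (h : Near d u v) : Near e u v := by
  unfold Near at *
  simp only [abs_le] at *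
  omega

theorem near_of_mem_neighborhood (hab : a < b) {v w : ℤ × ℤ} (h : w ∈ neighborhood a b v) :
    Near b w v := by
  obtain ⟨-, h⟩ := h
  unfold Near
  simp only [abs_le] at *
  omega

/-- `K` is connected if sites at distance at most `d` are joined. -/
def Linked (d : ℕ) (K : Set (ℤ × ℤ)) : Prop :=
  ∀ T ⊆ K, T.Nonempty → T ≠ K → ∃ t ∈ T, ∃ c ∈ K, c ∉ T ∧ Near d t c

/-- Linked sets that all come close to one site `v` stay linked when joined through `v`: a proper
part containing `v` leaves some member, or misses it entirely and links to it from `v`. -/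
theorem Linked.star {d : ℕ} {v : ℤ × ℤ} {𝒢 : Set (Set (ℤ × ℤ))} (h : ∀ K ∈ 𝒢, Linked d K)
    (hv : ∀ K ∈ 𝒢, ∃ w ∈ K, Near d w v) : Linked d ({v} ∪ ⋃₀ 𝒢) := by
  intro T hT hTne hTK
  by_cases hvT : v ∈ T
  · obtain ⟨c, hc, hcT⟩ : ∃ c ∈ {v} ∪ ⋃₀ 𝒢, c ∉ T := by
      by_contra! hcon
      exact hTK (Set.Subset.antisymm hT hcon)
    rcases hc with hc | ⟨K, hK, hcK⟩
    · exact absurd (hc ▸ hvT) hcT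
    · by_cases hne : (T ∩ K).Nonempty
      · obtain ⟨t, ht, c', hc', hc'T, hn⟩ := h K hK (T ∩ K) Set.inter_subset_right hne
          (fun he => hcT (he.symm ▸ hcK : c ∈ T ∩ K).1)
        exact ⟨t, ht.1, c', Or.inr ⟨K, hK, hc'⟩, fun h' => hc'T ⟨h', hc'⟩, hn⟩
      · obtain ⟨w, hw, hwv⟩ := hv K hK
        exact ⟨v, hvT, w, Or.inr ⟨K, hK, hw⟩, fun h' => hne ⟨w, h', hw⟩, hwv.symm⟩
  · obtain ⟨t, ht⟩ := hTne
    rcases hT ht with h' | ⟨K, hK, htK⟩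
    · exact absurd (h' ▸ ht) hvT
    · by_cases hsub : K ⊆ T
      · obtain ⟨w, hw, hwv⟩ := hv K hK
        exact ⟨w, hsub hw, v, Or.inl rfl, hvT, hwv⟩
      · obtain ⟨t', ht', c', hc', hc'T, hn⟩ := h K hK (T ∩ K) Set.inter_subset_right ⟨t, ht, htK⟩
          (fun he => hsub (Set.inter_eq_right.1 he))
        exact ⟨t', ht'.1, c', Or.inr ⟨K, hK, hc'⟩, fun h'' => hc'T ⟨h'', hc'⟩, hn⟩

/-- A discrete intermediate value theorem: the link that leaves the part of `K` below level `c`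
overshoots by less than `d`. -/
theorem Linked.exists_mem_Ico {d : ℕ} {K : Set (ℤ × ℤ)} (hK : Linked d K) (f : ℤ × ℤ → ℤ)
    (hf : ∀ u v, Near d u v → |f u - f v| ≤ d) {z z' : ℤ × ℤ} (hz : z ∈ K) (hz' : z' ∈ K) {c : ℤ}
    (h : f z < c) (h' : c ≤ f z') : ∃ u ∈ K, c ≤ f u ∧ f u < c + d := by
  obtain ⟨t, ht, u, hu, huT, hn⟩ := hK {w ∈ K | f w < c} (Set.sep_subset _ _) ⟨z, hz, h⟩
    (fun he => by
      have : z' ∈ {w ∈ K | f w < c} := he.symm ▸ hz'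
      exact absurd this.2 (not_lt.2 h'))
  have h1 : c ≤ f u := not_lt.1 fun h => huT ⟨hu, h⟩
  have h2 := hf t u hn
  have h3 : f t < c := ht.2
  rw [abs_le] at h2
  exact ⟨u, hu, h1, by omega⟩

/-- The sites of the rectangle `R` that lie in `S`, where `S` is a strip whose sites have few
neighbors outside, contain `r` occupied sites close to each other as soon as a connected set of
finally occupied sites traverses `S`. -/
theorem exists_cluster_of_traversed (hab : a < b) {R A S K : Set (ℤ × ℤ)} {r M : ℕ} (hr : 1 ≤ r)
    (hM : r * b ≤ M) (hM' : b ≤ M) (hK : Linked b K) (hKR : K ⊆ R)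
    (hKF : K ⊆ finalConfig a b R A) {u : ℤ × ℤ} (hu : u ∈ K)
    (huS : ∀ v ∈ R, Near M u v → v ∈ S) (hfar : ∃ z ∈ K, ¬ Near M u z)
    (hS : ∀ v ∈ S, (neighborhood a b v \ S).ncard + r ≤ a + b) :
    ∃ v ∈ R ∩ S, ∃ T : Finset (ℤ × ℤ), T.card = r ∧ ∀ w ∈ T, w ∈ A ∩ S ∧ Near M v w := by
  by_contra! hcon
  -- Without a cluster, `A ∪ Sᶜ` is stable: a site of `S` has fewer than `r` neighbours in `A ∩ S`,
  -- and those outside `S` cannot make up the difference. So the dynamics creates nothing inside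
  -- `S`.
  have hS0 : finalConfig a b R A ⊆ A ∪ Sᶜ := by
    refine finalConfig_subset Set.subset_union_left fun v hv hcard => ?_
    by_contra hvA
    simp only [Set.mem_union, Set.mem_compl_iff, not_or, not_not] at hvA
    have hfin : (neighborhood a b v ∩ (A ∩ S)).Finite :=
      (neighborhood_finite a b v).subset Set.inter_subset_left
    have hlt : (neighborhood a b v ∩ (A ∩ S)).ncard < r := by
      by_contra hge
      rw [Set.ncard_eq_toFinset_card _ hfin] at hge
      obtain ⟨T, hT, hTr⟩ := Finset.exists_subset_card_eq (not_lt.1 hge)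
      obtain ⟨w, hwT, hw⟩ := hcon v ⟨hv, hvA.2⟩ T hTr
      have hw' := hT hwT
      rw [Set.Finite.mem_toFinset] at hw'
      exact hw hw'.2 ((near_of_mem_neighborhood hab hw'.1).mono hM').symm
    have hsub : neighborhood a b v ∩ (A ∪ Sᶜ) ⊆
        (neighborhood a b v \ S) ∪ (neighborhood a b v ∩ (A ∩ S)) := by
      rintro w ⟨hw, hw' | hw'⟩
      · by_cases hwS : w ∈ S
        · exact Or.inr ⟨hw, hw', hwS⟩
        · exact Or.inl ⟨hw, hwS⟩
      · exact Or.inl ⟨hw, hw'⟩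
    have h1 := Set.ncard_le_ncard hsub (((neighborhood_finite a b v).subset
      Set.sdiff_subset).union hfin)
    have h2 := Set.ncard_union_le (neighborhood a b v \ S) (neighborhood a b v ∩ (A ∩ S))
    have h3 := hS v hvA.2
    omega
  -- Following links of `K` from `u` collects `n` sites within distance `(n - 1) * b`; the far site
  -- of `K` prevents the process from stopping. Near `u` these sites lie in `S`, hence in `A`, and
  -- form the forbidden cluster.
  have hgrow : ∀ n, 1 ≤ n → n ≤ r → ∃ T : Finset (ℤ × ℤ), T.card = n ∧ u ∈ T ∧
      ∀ w ∈ T, w ∈ K ∧ Near ((n - 1) * b) u w := by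
    intro n hn
    induction n, hn using Nat.le_induction with
    | base => exact fun _ => ⟨{u}, by simp, by simp, by simp [hu, near_refl]⟩
    | succ n hn ih =>
      intro hnr
      obtain ⟨T, hTc, huT, hT⟩ := ih (by omega)
      obtain ⟨z, hz, hzM⟩ := hfar
      have hle : (n - 1) * b ≤ M := le_trans (Nat.mul_le_mul_right b (by omega)) hM
      obtain ⟨t, ht, c, hc, hcT, hn'⟩ := hK (T : Set (ℤ × ℤ)) (fun w hw => (hT w hw).1) ⟨u, huT⟩
        (fun he => hzM (((hT z (by exact_mod_cast he.symm ▸ hz)).2).mono hle))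
      refine ⟨insert c T, ?_, Finset.mem_insert_of_mem huT, ?_⟩
      · rw [Finset.card_insert_of_notMem (by simpa using hcT), hTc]
      · have e : (n - 1) * b + b = (n + 1 - 1) * b := by
          obtain ⟨k, rfl⟩ : ∃ k, n = k + 1 := ⟨n - 1, by omega⟩
          simp; ring
        intro w hw
        rcases Finset.mem_insert.1 hw with rfl | hw
        · exact ⟨hc, e ▸ ((hT t (by simpa using ht)).2).trans hn'⟩
        · exact ⟨(hT w hw).1, ((hT w hw).2).mono (by omega)⟩
  obtain ⟨T, hTc, -, hT⟩ := hgrow r hr le_rfl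
  have hle : (r - 1) * b ≤ M := le_trans (Nat.mul_le_mul_right b (by omega)) hM
  obtain ⟨w, hwT, hw⟩ := hcon u ⟨hKR hu, huS u (hKR hu) (near_refl _ _)⟩ T hTc
  have hnear := ((hT w hwT).2).mono hle
  have hwS := huS w (hKR (hT w hwT).1) hnear
  refine hw ⟨?_, hwS⟩ hnear
  rcases hS0 (hKF (hT w hwT).1) with h | h
  · exact h
  · exact absurd hwS h

/-- A strip at least 2a wide lets a site reach outside on one side only, and only along its row,
hence to at most `a` sites. The sign `σ` records the side. -/
theorem ncard_neighborhood_sdiff_vertical_le {c m : ℤ} (hm : 2 * a ≤ m) {v : ℤ × ℤ}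
    (hv : c ≤ v.1 ∧ v.1 < c + m) :
    (neighborhood a b v \ {w | c ≤ w.1 ∧ w.1 < c + m}).ncard ≤ a := by
  have key : ∀ σ : ℤ, (neighborhood a b v \ {w | c ≤ w.1 ∧ w.1 < c + m} ⊆
      (fun i : ℕ => ((v.1 + σ * (i + 1), v.2) : ℤ × ℤ)) '' (Set.Iio a)) →
      (neighborhood a b v \ {w | c ≤ w.1 ∧ w.1 < c + m}).ncard ≤ a := by
    intro σ h
    refine (Set.ncard_le_ncard h ((Set.finite_Iio a).image _)).trans ?_
    refine (Set.ncard_image_le (Set.finite_Iio a)).trans ?_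
    rw [Set.ncard_eq_toFinset_card']; simp
  by_cases h : c + a ≤ v.1
  · refine key 1 ?_
    rintro ⟨x, y⟩ ⟨⟨-, hw⟩, hwS⟩
    simp only [abs_le, Set.mem_ofPred_eq] at hw hwS
    exact ⟨(x - v.1 - 1).toNat, by simp only [Set.mem_Iio]; omega, by
      simp only [Prod.mk.injEq]; omega⟩
  · refine key (-1) ?_
    rintro ⟨x, y⟩ ⟨⟨-, hw⟩, hwS⟩
    simp only [abs_le, Set.mem_ofPred_eq] at hw hwS
    exact ⟨(v.1 - x - 1).toNat, by simp only [Set.mem_Iio]; omega, by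
      simp only [Prod.mk.injEq]; omega⟩

theorem ncard_neighborhood_sdiff_horizontal_le {c m : ℤ} (hm : 2 * b ≤ m) {v : ℤ × ℤ}
    (hv : c ≤ v.2 ∧ v.2 < c + m) :
    (neighborhood a b v \ {w | c ≤ w.2 ∧ w.2 < c + m}).ncard ≤ b := by
  have key : ∀ σ : ℤ, (neighborhood a b v \ {w | c ≤ w.2 ∧ w.2 < c + m} ⊆
      (fun i : ℕ => ((v.1, v.2 + σ * (i + 1)) : ℤ × ℤ)) '' (Set.Iio b)) →
      (neighborhood a b v \ {w | c ≤ w.2 ∧ w.2 < c + m}).ncard ≤ b := by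
    intro σ h
    refine (Set.ncard_le_ncard h ((Set.finite_Iio b).image _)).trans ?_
    refine (Set.ncard_image_le (Set.finite_Iio b)).trans ?_
    rw [Set.ncard_eq_toFinset_card']; simp
  by_cases h : c + b ≤ v.2
  · refine key 1 ?_
    rintro ⟨x, y⟩ ⟨⟨-, hw⟩, hwS⟩
    simp only [abs_le, Set.mem_ofPred_eq] at hw hwS
    exact ⟨(y - v.2 - 1).toNat, by simp only [Set.mem_Iio]; omega, by
      simp only [Prod.mk.injEq]; omega⟩
  · refine key (-1) ?_
    rintro ⟨x, y⟩ ⟨⟨-, hw⟩, hwS⟩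
    simp only [abs_le, Set.mem_ofPred_eq] at hw hwS
    exact ⟨(v.2 - y - 1).toNat, by simp only [Set.mem_Iio]; omega, by
      simp only [Prod.mk.injEq]; omega⟩

/-- The width of the strips that a growing droplet cannot traverse without help. -/
def stripWidth (b : ℕ) : ℕ := 2 * b ^ 2 + b + 1

/-- The set `G` contains `r` occupied sites at distance at most `M` from one of its sites. -/
def HasCluster (r M : ℕ) (G S : Finset (ℤ × ℤ)) : Prop :=
  ∃ v ∈ G, ∃ T ⊆ S ∩ G, T.card = r ∧ ∀ w ∈ T, Near M v w

/-- The vertical strip of width `m` with left side `c` in the rectangle `[u, w]`. -/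
noncomputable def vstrip (u w : ℤ × ℤ) (m : ℕ) (c : ℤ) : Finset (ℤ × ℤ) :=
  (Finset.Icc u w).filter fun v => c ≤ v.1 ∧ v.1 < c + m

/-- The horizontal strip of height `m` with lower side `c` in the rectangle `[u, w]`. -/
noncomputable def hstrip (u w : ℤ × ℤ) (m : ℕ) (c : ℤ) : Finset (ℤ × ℤ) :=
  (Finset.Icc u w).filter fun v => c ≤ v.2 ∧ v.2 < c + m

/-- With at most `a` helping neighbours outside the strip, the threshold `a + b` leaves `b` sites to
be supplied from within. This is the expensive direction of growth. -/
theorem hasCluster_vstrip (ha : 1 ≤ a) (hab : a < b) {S : Finset (ℤ × ℤ)} {K : Set (ℤ × ℤ)}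
    {u w : ℤ × ℤ} (hK : Linked b K) (hKR : K ⊆ Set.Icc u w)
    (hKF : K ⊆ finalConfig a b (Set.Icc u w) (S ∩ Set.Icc u w))
    (hu : ∃ z ∈ K, z.1 = u.1) (hw : ∃ z ∈ K, z.1 = w.1) {c : ℤ} (hc : u.1 ≤ c)
    (hcw : c + stripWidth b ≤ w.1 + 1) :
    HasCluster b (b ^ 2) (vstrip u w (stripWidth b) c) S := by
  obtain ⟨z, hz, hzu⟩ := hu
  obtain ⟨z', hz', hzw⟩ := hw
  have hb2 : b ≤ b ^ 2 := by nlinarith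
  have hm : (stripWidth b : ℤ) = 2 * ((b ^ 2 : ℕ) : ℤ) + b + 1 := by simp [stripWidth]
  -- Linkedness puts a site of `K` into the middle `b` columns. The margins `b ^ 2` on both sides
  -- keep its ball inside the strip, and the final `+ 1` in `stripWidth` puts the right end of `K`
  -- beyond that ball.
  obtain ⟨t, ht, htc, htc'⟩ := hK.exists_mem_Ico Prod.fst (fun _ _ h => h.1) hz hz'
    (c := c + (b ^ 2 : ℕ)) (by omega) (by omega)
  obtain ⟨v, hv, T, hT, hTv⟩ := exists_cluster_of_traversed (r := b) (M := b ^ 2) hab (by omega)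
    (by rw [sq]) hb2 hK hKR hKF ht
    (S := {v | c ≤ v.1 ∧ v.1 < c + stripWidth b})
    (fun v _ hn => by
      simp only [Near, abs_le] at hn
      simp only [Set.mem_ofPred_eq]
      omega)
    (⟨z', hz', fun hn => by simp only [Near, abs_le] at hn; omega⟩)
    (fun v hv => by
      have := ncard_neighborhood_sdiff_vertical_le (a := a) (b := b) (m := stripWidth b)
        (by omega) hv
      omega)
  refine ⟨v, ?_, T, fun x hx => ?_, hT, fun x hx => (hTv x hx).2⟩
  · simp only [vstrip, Finset.mem_filter, Finset.mem_Icc]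
    exact ⟨hv.1, hv.2⟩
  · have := (hTv x hx).1
    simp only [vstrip, Finset.mem_inter, Finset.mem_filter, Finset.mem_Icc]
    exact ⟨by simpa using this.1.1, this.1.2, this.2⟩

theorem hasCluster_hstrip (ha : 1 ≤ a) (hab : a < b) {S : Finset (ℤ × ℤ)} {K : Set (ℤ × ℤ)}
    {u w : ℤ × ℤ} (hK : Linked b K) (hKR : K ⊆ Set.Icc u w)
    (hKF : K ⊆ finalConfig a b (Set.Icc u w) (S ∩ Set.Icc u w))
    (hu : ∃ z ∈ K, z.2 = u.2) (hw : ∃ z ∈ K, z.2 = w.2) {c : ℤ} (hc : u.2 ≤ c)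
    (hcw : c + stripWidth b ≤ w.2 + 1) :
    HasCluster a (b ^ 2) (hstrip u w (stripWidth b) c) S := by
  obtain ⟨z, hz, hzu⟩ := hu
  obtain ⟨z', hz', hzw⟩ := hw
  have hb2 : b ≤ b ^ 2 := by nlinarith
  have hm : (stripWidth b : ℤ) = 2 * ((b ^ 2 : ℕ) : ℤ) + b + 1 := by simp [stripWidth]
  obtain ⟨t, ht, htc, htc'⟩ := hK.exists_mem_Ico Prod.snd (fun _ _ h => h.2) hz hz'
    (c := c + (b ^ 2 : ℕ)) (by omega) (by omega)
  obtain ⟨v, hv, T, hT, hTv⟩ := exists_cluster_of_traversed (r := a) (M := b ^ 2) hab ha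
    (by rw [sq]; exact Nat.mul_le_mul_right b hab.le) hb2 hK hKR
    hKF ht (S := {v | c ≤ v.2 ∧ v.2 < c + stripWidth b})
    (fun v _ hn => by
      simp only [Near, abs_le] at hn
      simp only [Set.mem_ofPred_eq]
      omega)
    (⟨z', hz', fun hn => by simp only [Near, abs_le] at hn; omega⟩)
    (fun v hv => by
      have := ncard_neighborhood_sdiff_horizontal_le (a := a) (b := b) (m := stripWidth b)
        (by omega) hv
      omega)
  refine ⟨v, ?_, T, fun x hx => ?_, hT, fun x hx => (hTv x hx).2⟩
  · simp only [hstrip, Finset.mem_filter, Finset.mem_Icc]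
    exact ⟨hv.1, hv.2⟩
  · have := (hTv x hx).1
    simp only [hstrip, Finset.mem_inter, Finset.mem_filter, Finset.mem_Icc]
    exact ⟨by simpa using this.1.1, this.1.2, this.2⟩

/-! ### Droplets and the Aizenman–Lebowitz lemma. -/

/-- Every site of `K` becomes occupied by the dynamics inside any rectangle that contains `K`. -/
def SelfSpanned (a b : ℕ) (A K : Set (ℤ × ℤ)) : Prop :=
  ∀ u w : ℤ × ℤ, K ⊆ Set.Icc u w → K ⊆ finalConfig a b (Set.Icc u w) (A ∩ Set.Icc u w)

/-- The horizontal extension of `K` is less than `k` and its vertical extension less than `h`. -/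
def SmallerThan (k h : ℕ) (K : Set (ℤ × ℤ)) : Prop :=
  ∀ z ∈ K, ∀ z' ∈ K, z.1 - z'.1 < k ∧ z.2 - z'.2 < h

/-- Nonempty, connected, self-spanned subsets of `D`. -/
structure Droplet (a b : ℕ) (D A K : Set (ℤ × ℤ)) : Prop where
  nonempty : K.Nonempty
  subset : K ⊆ D
  linked : Linked b K
  spanned : SelfSpanned a b A K

/-- Spanning inside every enclosing rectangle is inherited by unions: a rectangle around the union
encloses each member, and once all members are occupied `v` is too. -/
theorem Droplet.star {D A : Set (ℤ × ℤ)} {v : ℤ × ℤ} {𝒢 : Set (Set (ℤ × ℤ))}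
    (hvD : v ∈ D) (h𝒢 : ∀ K ∈ 𝒢, Droplet a b D A K) (hv : ∀ K ∈ 𝒢, ∃ w ∈ K, Near b w v)
    (hvs : v ∈ A ∨ v ∈ ⋃₀ 𝒢 ∨ a + b ≤ (neighborhood a b v ∩ ⋃₀ 𝒢).ncard) :
    Droplet a b D A ({v} ∪ ⋃₀ 𝒢) := by
  refine ⟨⟨v, Or.inl rfl⟩, ?_, Linked.star (fun K hK => (h𝒢 K hK).linked) hv, ?_⟩
  · rintro z (rfl | ⟨K, hK, hz⟩)
    · exact hvD
    · exact (h𝒢 K hK).subset hz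
  · intro u w hR
    have hU : ⋃₀ 𝒢 ⊆ finalConfig a b (Set.Icc u w) (A ∩ Set.Icc u w) := by
      rintro z ⟨K, hK, hz⟩
      exact (h𝒢 K hK).spanned u w
        (fun y hy => hR (Or.inr ⟨K, hK, hy⟩)) hz
    have hvR : v ∈ Set.Icc u w := hR (Or.inl rfl)
    rintro z (rfl | hz)
    · rcases hvs with h | h | h
      · exact subset_finalConfig _ _ ⟨h, hvR⟩
      · exact hU h
      · exact mem_finalConfig_of_le hvR (h.trans (Set.ncard_le_ncard
          (Set.inter_subset_inter_right _ hU)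
          ((neighborhood_finite a b z).subset Set.inter_subset_left)))
    · exact hU hz

theorem SmallerThan.star {k h d : ℕ} (hk : 1 ≤ k) (hh : 1 ≤ h) {v : ℤ × ℤ} {𝒢 : Set (Set (ℤ × ℤ))}
    (h𝒢 : ∀ K ∈ 𝒢, SmallerThan k h K) (hv : ∀ K ∈ 𝒢, ∃ w ∈ K, Near d w v) :
    SmallerThan (2 * k + 2 * d) (2 * h + 2 * d) ({v} ∪ ⋃₀ 𝒢) := by
  have key : ∀ z ∈ {v} ∪ ⋃₀ 𝒢, |z.1 - v.1| < k + d ∧ |z.2 - v.2| < h + d := by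
    rintro z (rfl | ⟨K, hK, hz⟩)
    · simp only [sub_self, abs_zero]; omega
    · obtain ⟨w, hw, hwv⟩ := hv K hK
      have h1 := h𝒢 K hK z hz w hw
      have h2 := h𝒢 K hK w hw z hz
      simp only [Near, abs_le] at hwv
      simp only [abs_lt]
      omega
  intro z hz z' hz'
  have h1 := key z hz
  have h2 := key z' hz'
  simp only [abs_lt] at h1 h2
  push_cast
  omega

theorem mem_square {L : ℕ} {v : ℤ × ℤ} :
    v ∈ square L ↔ (0 ≤ v.1 ∧ v.1 ≤ L) ∧ 0 ≤ v.2 ∧ v.2 ≤ L := by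
  simp only [square, Set.mem_prod, Set.mem_Icc]

/-- An Aizenman–Lebowitz lemma: an internally spanned square contains droplets on all scales. -/
theorem exists_droplet_of_spanned (hab : a < b) {L k h : ℕ} (hk : 1 ≤ k) (hh : 1 ≤ h) (hkL : k ≤ L)
    {A : Set (ℤ × ℤ)} (hA : A ⊆ square L) (hs : square L ⊆ finalConfig a b (square L) A) :
    ∃ K, Droplet a b (square L) A K ∧ SmallerThan (2 * k + 2 * b) (2 * h + 2 * b) K ∧
      ¬ SmallerThan k h K := by
  by_contra! hcon
  -- If no droplet has an intermediate size, joining small droplets at a site, which at most doubles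
  -- sizes up to `2 * b`, yields a small droplet again. So `𝒮` is closed under joining, and its
  -- union is stable.
  set 𝒮 : Set (Set (ℤ × ℤ)) := {K | Droplet a b (square L) A K ∧ SmallerThan k h K} with h𝒮
  have star : ∀ v ∈ square L, ∀ 𝒢 ⊆ 𝒮, (∀ K ∈ 𝒢, ∃ w ∈ K, Near b w v) →
      (v ∈ A ∨ v ∈ ⋃₀ 𝒢 ∨ a + b ≤ (neighborhood a b v ∩ ⋃₀ 𝒢).ncard) → {v} ∪ ⋃₀ 𝒢 ∈ 𝒮 := by
    intro v hv 𝒢 h𝒢 hnear hvs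
    have h1 := Droplet.star hv (fun K hK => (h𝒢 hK).1) hnear hvs
    exact ⟨h1, hcon _ h1 (SmallerThan.star hk hh (fun K hK => (h𝒢 hK).2) hnear)⟩
  have hU : finalConfig a b (square L) A ⊆ ⋃₀ 𝒮 := by
    refine finalConfig_subset (fun v hv => ?_) (fun v hv hcard => ?_)
    · exact ⟨_, star v (hA hv) ∅ (Set.empty_subset _) (by simp) (Or.inl hv), Or.inl rfl⟩
    · refine ⟨_, star v hv {K ∈ 𝒮 | ∃ w ∈ K, Near b w v} (Set.sep_subset _ _)
        (fun K hK => hK.2) (Or.inr (Or.inr ?_)), Or.inl rfl⟩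
      refine hcard.trans (Set.ncard_le_ncard ?_
        ((neighborhood_finite a b v).subset Set.inter_subset_left))
      rintro w ⟨hw, K, hK, hwK⟩
      exact ⟨hw, K, ⟨hK, w, hwK, near_of_mem_neighborhood hab hw⟩, hwK⟩
  -- Since all sites are covered by small droplets, joining them one after another along the bottom
  -- row gives a small droplet of extension `L ≥ k`, a contradiction.
  have hline : ∀ n : ℕ, n ≤ L → ∃ K ∈ 𝒮, ((0, 0) : ℤ × ℤ) ∈ K ∧ ((n, 0) : ℤ × ℤ) ∈ K := by
    intro n
    induction n with
    | zero =>
      intro _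
      obtain ⟨K, hK, h0⟩ := hU (hs (mem_square.2 (by simp) : ((0, 0) : ℤ × ℤ) ∈ square L))
      exact ⟨K, hK, h0, by simpa using h0⟩
    | succ n ih =>
      intro hn
      obtain ⟨K, hK, h0, h1⟩ := ih (by omega)
      have hmem : (((n + 1 : ℕ) : ℤ), (0 : ℤ)) ∈ square L := mem_square.2 (by
        simp only []; omega)
      obtain ⟨K', hK', h2⟩ := hU (hs hmem)
      refine ⟨_, star _ hmem {K, K'} ?_ ?_ (Or.inr (Or.inl ⟨K', by simp, h2⟩)),
        Or.inr ⟨K, by simp, h0⟩, Or.inl rfl⟩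
      · rintro _ (rfl | rfl) <;> assumption
      · rintro _ (rfl | rfl)
        · refine ⟨_, h1, ?_⟩
          simp only [Near, abs_le]
          push_cast
          omega
        · exact ⟨_, h2, near_refl _ _⟩
  obtain ⟨K, hK, h0, h1⟩ := hline L le_rfl
  have := (hK.2 _ h1 _ h0).1
  simp only [] at this
  omega

theorem Droplet.exists_rectangle {L : ℕ} {A K : Set (ℤ × ℤ)} (hK : Droplet a b (square L) A K) :
    ∃ u ∈ square L, ∃ w ∈ square L, K ⊆ Set.Icc u w ∧ (∃ z ∈ K, z.1 = u.1) ∧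
      (∃ z ∈ K, z.1 = w.1) ∧ (∃ z ∈ K, z.2 = u.2) ∧ (∃ z ∈ K, z.2 = w.2) := by
  have hfin : K.Finite := (((Set.finite_Icc (0 : ℤ) L).prod (Set.finite_Icc (0 : ℤ) L))).subset
    hK.subset
  obtain ⟨z1, h1, m1⟩ := Set.exists_min_image K Prod.fst hfin hK.nonempty
  obtain ⟨z2, h2, m2⟩ := Set.exists_max_image K Prod.fst hfin hK.nonempty
  obtain ⟨z3, h3, m3⟩ := Set.exists_min_image K Prod.snd hfin hK.nonempty
  obtain ⟨z4, h4, m4⟩ := Set.exists_max_image K Prod.snd hfin hK.nonempty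
  have s1 := mem_square.1 (hK.subset h1)
  have s2 := mem_square.1 (hK.subset h2)
  have s3 := mem_square.1 (hK.subset h3)
  have s4 := mem_square.1 (hK.subset h4)
  refine ⟨(z1.1, z3.2), mem_square.2 ⟨s1.1, s3.2⟩, (z2.1, z4.2), mem_square.2 ⟨s2.1, s4.2⟩,
    fun z hz => ⟨⟨m1 z hz, m3 z hz⟩, ⟨m2 z hz, m4 z hz⟩⟩, ⟨z1, h1, rfl⟩, ⟨z2, h2, rfl⟩,
    ⟨z3, h3, rfl⟩, ⟨z4, h4, rfl⟩⟩

end Dynamics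

/-! ### Probability that a droplet crosses its strips. -/

section ClusterBounds

variable {a b : ℕ}

/-- The sites of `[0,L]²`, as a finite set. -/
noncomputable def sites (L : ℕ) : Finset (ℤ × ℤ) := Finset.Icc 0 (L : ℤ) ×ˢ Finset.Icc 0 (L : ℤ)

theorem coe_sites (L : ℕ) : (sites L : Set (ℤ × ℤ)) = square L := by
  simp [sites, square]

theorem mem_sites {L : ℕ} {v : ℤ × ℤ} :
    v ∈ sites L ↔ (0 ≤ v.1 ∧ v.1 ≤ L) ∧ 0 ≤ v.2 ∧ v.2 ≤ L := by
  simp only [sites, Finset.mem_product, Finset.mem_Icc]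

theorem card_sites (L : ℕ) : (sites L).card = (L + 1) ^ 2 := by
  simp [sites, sq]

theorem spanProb_eq_bprob (a b L : ℕ) (p : unitInterval) :
    spanProb a b L p =
      bprob (p : ℝ) (sites L) {S | square L ⊆ finalConfig a b (square L) S} := by
  rw [spanProb, ← coe_sites, setBernoulli_real_eq_bprob]
  have h : ∀ S ⊆ sites L, InternallySpanned a b (sites L) (S : Set (ℤ × ℤ)) ↔
      (sites L : Set (ℤ × ℤ)) ⊆ finalConfig a b (sites L) S := by
    intro S hS
    have hS' : (S : Set (ℤ × ℤ)) ⊆ sites L := by exact_mod_cast hS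
    rw [InternallySpanned, Set.inter_eq_left.2 hS']
    exact ⟨fun h => h.ge, fun h => (finalConfig_subset hS' fun v hv _ => hv).antisymm h⟩
  exact le_antisymm (bprob_mono p.2.1 p.2.2 fun S hS h' => (h S hS).1 h')
    (bprob_mono p.2.1 p.2.2 fun S hS h' => (h S hS).2 h')

/-- The number of subsets of an `ℓ^∞`-ball of radius `M`. -/
def ballSubsets (M : ℕ) : ℕ := 2 ^ ((2 * M + 1) ^ 2)

theorem bprob_exists_cluster_near_le {p : ℝ} (hp0 : 0 ≤ p) (hp1 : p ≤ 1) (r M : ℕ)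
    (G : Finset (ℤ × ℤ)) (v : ℤ × ℤ) :
    bprob p G {S | ∃ T ⊆ S ∩ G, T.card = r ∧ ∀ w ∈ T, Near M v w} ≤ ballSubsets M * p ^ r := by
  set B : Finset (ℤ × ℤ) := Finset.Icc (v.1 - M) (v.1 + M) ×ˢ Finset.Icc (v.2 - M) (v.2 + M)
  have hB : B.card = (2 * M + 1) ^ 2 := by
    have : ∀ x : ℤ, (x + M + 1 - (x - M)).toNat = 2 * M + 1 := fun x => by omega
    simp [B, this, sq]
  refine (bprob_le_sum hp0 hp1 ((G ∩ B).powersetCard r) (fun T => {S | T ⊆ S}) ?_).trans ?_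
  · rintro S hS ⟨T, hT, hTr, hn⟩
    refine ⟨T, Finset.mem_powersetCard.2 ⟨fun w hw => Finset.mem_inter.2
      ⟨(Finset.mem_inter.1 (hT hw)).2, ?_⟩, hTr⟩, hT.trans Finset.inter_subset_left⟩
    have := hn w hw
    simp only [Near, abs_le] at this
    simp only [B, Finset.mem_product, Finset.mem_Icc]
    omega
  · have h1 : ∀ T ∈ (G ∩ B).powersetCard r, bprob p G {S | T ⊆ S} = p ^ r := fun T hT => by
      rw [Finset.mem_powersetCard] at hT
      rw [bprob_superset p (hT.1.trans Finset.inter_subset_left), hT.2]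
    rw [Finset.sum_congr rfl h1, Finset.sum_const, nsmul_eq_mul]
    refine mul_le_mul_of_nonneg_right ?_ (by positivity)
    have h2 : ((G ∩ B).powersetCard r).card ≤ ballSubsets M := by
      rw [Finset.card_powersetCard]
      refine (Nat.choose_le_two_pow _ _).trans ?_
      rw [ballSubsets, ← hB]
      exact Nat.pow_le_pow_right (by norm_num) (Finset.card_le_card Finset.inter_subset_right)
    exact_mod_cast h2

theorem bprob_hasCluster_le {p : ℝ} (hp0 : 0 ≤ p) (hp1 : p ≤ 1) (r M : ℕ) (G : Finset (ℤ × ℤ)) :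
    bprob p G {S | HasCluster r M G S} ≤ G.card * (ballSubsets M * p ^ r) := by
  refine (bprob_le_sum hp0 hp1 G
    (fun v => {S | ∃ T ⊆ S ∩ G, T.card = r ∧ ∀ w ∈ T, Near M v w}) fun S _ h => h).trans ?_
  refine (Finset.sum_le_card_nsmul G _ _
    fun v _ => bprob_exists_cluster_near_le hp0 hp1 r M G v).trans ?_
  rw [nsmul_eq_mul]

/-- For long horizontal strips the union bound may exceed 1. The absence of a cluster near `v` is a
decreasing event for every `v`, so Harris' inequality bounds the probability of having none from
below by a product. -/
theorem bprob_hasCluster_le_one_sub {p : ℝ} (hp0 : 0 ≤ p) (hp1 : p ≤ 1) (r M : ℕ)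
    (G : Finset (ℤ × ℤ)) (hC : ballSubsets M * p ^ r ≤ 1) :
    bprob p G {S | HasCluster r M G S} ≤ 1 - (1 - ballSubsets M * p ^ r) ^ G.card := by
  have h1 := prod_bprob_le_of_isLowerSet hp0 hp1 G G
    (fun v => {S | ∃ T ⊆ S ∩ G, T.card = r ∧ ∀ w ∈ T, Near M v w}ᶜ) (fun v _ => by
      refine IsUpperSet.compl ?_
      rintro S S' hSS ⟨T, hT, hT'⟩
      exact ⟨T, hT.trans (Finset.inter_subset_inter_right hSS), hT'⟩)
  have h2 : {S : Finset (ℤ × ℤ) | ∀ v ∈ G, S ∈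
      {S | ∃ T ⊆ S ∩ G, T.card = r ∧ ∀ w ∈ T, Near M v w}ᶜ} = {S | HasCluster r M G S}ᶜ := by
    ext S
    simp [HasCluster]
  rw [h2, bprob_compl] at h1
  have h3 : (1 - ballSubsets M * p ^ r) ^ G.card ≤ ∏ v ∈ G,
      bprob p G {S | ∃ T ⊆ S ∩ G, T.card = r ∧ ∀ w ∈ T, Near M v w}ᶜ := by
    rw [← Finset.prod_const]
    refine Finset.prod_le_prod (fun _ _ => by linarith) fun v _ => ?_
    rw [bprob_compl]
    linarith [bprob_exists_cluster_near_le hp0 hp1 r M G v]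
  linarith

theorem bprob_forall_hasCluster_le {p : ℝ} (hp0 : 0 ≤ p) (hp1 : p ≤ 1) {r M N : ℕ}
    {F : Finset (ℤ × ℤ)} (G : ℕ → Finset (ℤ × ℤ)) (hG : ∀ i < N, G i ⊆ F)
    (hd : ((Finset.range N : Finset ℕ) : Set ℕ).PairwiseDisjoint G) {q : ℝ}
    (hq : ∀ i < N, bprob p (G i) {S | HasCluster r M (G i) S} ≤ q) :
    bprob p F {S | ∀ i < N, HasCluster r M (G i) S} ≤ q ^ N := by
  have h := bprob_forall_of_pairwiseDisjoint p (F := F) (Finset.range N) G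
    (fun i hi => hG i (Finset.mem_range.1 hi)) hd (fun i => {S | HasCluster r M (G i) S})
  have e : {S : Finset (ℤ × ℤ) | ∀ i < N, HasCluster r M (G i) S} =
      {S | ∀ i ∈ Finset.range N, S ∩ G i ∈ {S | HasCluster r M (G i) S}} := by
    ext S
    simp [HasCluster, Finset.inter_assoc]
  rw [e, h, ← Finset.card_range N, ← Finset.prod_const, Finset.card_range]
  exact Finset.prod_le_prod (fun i _ => bprob_nonneg hp0 hp1 _ _)
    fun i hi => hq i (Finset.mem_range.1 hi)

theorem card_vstrip_le (u w : ℤ × ℤ) (m : ℕ) (c : ℤ) :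
    (vstrip u w m c).card ≤ m * (w.2 + 1 - u.2).toNat := by
  have : vstrip u w m c ⊆ Finset.Ico c (c + m) ×ˢ Finset.Icc u.2 w.2 := by
    intro v hv
    simp only [vstrip, Finset.mem_filter, Finset.mem_Icc, Prod.le_def] at hv
    simp only [Finset.mem_product, Finset.mem_Icc, Finset.mem_Ico]
    omega
  refine (Finset.card_le_card this).trans ?_
  simp

theorem card_hstrip_le (u w : ℤ × ℤ) (m : ℕ) (c : ℤ) :
    (hstrip u w m c).card ≤ m * (w.1 + 1 - u.1).toNat := by
  have : hstrip u w m c ⊆ Finset.Icc u.1 w.1 ×ˢ Finset.Ico c (c + m) := by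
    intro v hv
    simp only [hstrip, Finset.mem_filter, Finset.mem_Icc, Prod.le_def] at hv
    simp only [Finset.mem_product, Finset.mem_Icc, Finset.mem_Ico]
    omega
  refine (Finset.card_le_card this).trans ?_
  simp [mul_comm]

theorem add_mul_le_of_lt {c x : ℤ} {m i j : ℕ} (hx : x < c + i * m + m) (h : c + j * m ≤ x) :
    j ≤ i := by
  by_contra hij
  have h1 : ((i : ℤ) + 1) * m ≤ j * m := by
    refine mul_le_mul_of_nonneg_right ?_ (by positivity)
    omega
  linarith

theorem Icc_subset_sites {L : ℕ} {u w : ℤ × ℤ} (hu : u ∈ sites L) (hw : w ∈ sites L) :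
    Finset.Icc u w ⊆ sites L := by
  intro v hv
  simp only [Finset.mem_Icc, Prod.le_def] at hv
  rw [mem_sites] at *
  omega

theorem bprob_vstrips_le {p : ℝ} (hp0 : 0 ≤ p) (hp1 : p ≤ 1) {L r M m N : ℕ} {u w : ℤ × ℤ}
    (hu : u ∈ sites L) (hw : w ∈ sites L) {H : ℕ} (hH : w.2 - u.2 < H) :
    bprob p (sites L) {S | ∀ i < N, HasCluster r M (vstrip u w m (u.1 + i * m)) S} ≤
      ((m * H : ℕ) * (ballSubsets M * p ^ r)) ^ N := by
  refine bprob_forall_hasCluster_le hp0 hp1 (fun i => vstrip u w m (u.1 + i * m))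
    (fun i _ => (Finset.filter_subset _ _).trans (Icc_subset_sites hu hw)) ?_ fun i _ => ?_
  · intro i _ j _ hij
    refine Finset.disjoint_left.2 fun v hv hv' => hij ?_
    simp only [vstrip, Finset.mem_filter] at hv hv'
    exact le_antisymm (add_mul_le_of_lt hv'.2.2 hv.2.1) (add_mul_le_of_lt hv.2.2 hv'.2.1)
  · refine (bprob_hasCluster_le hp0 hp1 r M _).trans ?_
    refine mul_le_mul_of_nonneg_right ?_ (by positivity)
    have h1 : (vstrip u w m (u.1 + i * m)).card ≤ m * H :=
      (card_vstrip_le u w m _).trans (Nat.mul_le_mul_left m (by omega))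
    exact_mod_cast h1

theorem bprob_hstrips_le {p : ℝ} (hp0 : 0 ≤ p) (hp1 : p ≤ 1) {L r M m N : ℕ} {u w : ℤ × ℤ}
    (hC : ballSubsets M * p ^ r ≤ 1)
    (hu : u ∈ sites L) (hw : w ∈ sites L) {W : ℕ} (hW : w.1 - u.1 < W) :
    bprob p (sites L) {S | ∀ i < N, HasCluster r M (hstrip u w m (u.2 + i * m)) S} ≤
      (1 - (1 - ballSubsets M * p ^ r) ^ (m * W)) ^ N := by
  refine bprob_forall_hasCluster_le hp0 hp1 (fun i => hstrip u w m (u.2 + i * m))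
    (fun i _ => (Finset.filter_subset _ _).trans (Icc_subset_sites hu hw)) ?_ fun i _ => ?_
  · intro i _ j _ hij
    refine Finset.disjoint_left.2 fun v hv hv' => hij ?_
    simp only [hstrip, Finset.mem_filter] at hv hv'
    exact le_antisymm (add_mul_le_of_lt hv'.2.2 hv.2.1) (add_mul_le_of_lt hv.2.2 hv'.2.1)
  · refine (bprob_hasCluster_le_one_sub hp0 hp1 r M _ hC).trans ?_
    have h1 : (hstrip u w m (u.2 + i * m)).card ≤ m * W :=
      (card_hstrip_le u w m _).trans (Nat.mul_le_mul_left m (by omega))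
    have h2 : 0 ≤ ballSubsets M * p ^ r := by positivity
    linarith [pow_le_pow_of_le_one (by linarith : 0 ≤ 1 - ballSubsets M * p ^ r)
      (by linarith) h1]

/-- Union bound over the two corners of the rectangle around a droplet of intermediate size, which
gives the factor (L+1)^4. The first summand is for rectangles at least `k` wide, the second for
those at least `h` high; in each case the other dimension is bounded by the droplet lemma. -/
theorem bprob_spanned_le (ha : 1 ≤ a) (hab : a < b) {p : ℝ} (hp0 : 0 ≤ p) (hp1 : p ≤ 1)
    {L k h : ℕ} (hk : 1 ≤ k) (hh : 1 ≤ h) (hkL : k ≤ L)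
    (hC : ballSubsets (b ^ 2) * p ^ a ≤ 1) :
    bprob p (sites L) {S | square L ⊆ finalConfig a b (square L) S} ≤ ((L : ℝ) + 1) ^ 4 *
      (((stripWidth b * (2 * h + 2 * b) : ℕ) * (ballSubsets (b ^ 2) * p ^ b)) ^
          (k / stripWidth b) +
        (1 - (1 - ballSubsets (b ^ 2) * p ^ a) ^ (stripWidth b * (2 * k + 2 * b))) ^
          (h / stripWidth b)) := by
  set m := stripWidth b with hm
  set X := ((m * (2 * h + 2 * b) : ℕ) * (ballSubsets (b ^ 2) * p ^ b)) ^ (k / m) with hX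
  set Y := (1 - (1 - ballSubsets (b ^ 2) * p ^ a) ^ (m * (2 * k + 2 * b))) ^ (h / m) with hY
  have hX0 : 0 ≤ X := by positivity
  have hY0 : 0 ≤ Y := by
    refine pow_nonneg (sub_nonneg.2 (pow_le_one₀ (by linarith) ?_)) _
    have : 0 ≤ ballSubsets (b ^ 2) * p ^ a := by positivity
    linarith
  -- The size conditions do not depend on `S`, so for a fixed rectangle each alternative is either
  -- empty or an event about disjoint strips.
  let E : (ℤ × ℤ) × (ℤ × ℤ) → Set (Finset (ℤ × ℤ)) := fun z =>
    {S | (z.2.2 - z.1.2 < (2 * h + 2 * b : ℕ) ∧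
        ∀ i < k / m, HasCluster b (b ^ 2) (vstrip z.1 z.2 m (z.1.1 + i * m)) S) ∨
      (z.2.1 - z.1.1 < (2 * k + 2 * b : ℕ) ∧
        ∀ i < h / m, HasCluster a (b ^ 2) (hstrip z.1 z.2 m (z.1.2 + i * m)) S)}
  have hdiv : ∀ {i n : ℕ} {x y : ℤ}, i < n / m → x + n ≤ y → x + i * m + m ≤ y + 1 := by
    intro i n x y hi hn
    have h1 : (i + 1) * m ≤ n := (Nat.mul_le_mul_right m hi).trans (Nat.div_mul_le_self n m)
    have h2 : ((i : ℤ) + 1) * m ≤ n := by exact_mod_cast h1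
    linarith
  refine (bprob_le_sum hp0 hp1 (sites L ×ˢ sites L) E ?_).trans ?_
  · intro S hS hspan
    have hS' : (S : Set (ℤ × ℤ)) ⊆ square L := by
      rw [← coe_sites]; exact_mod_cast hS
    obtain ⟨K, hK, hsmall, hbig⟩ := exists_droplet_of_spanned hab hk hh hkL hS' hspan
    obtain ⟨u, hu, w, hw, hR, h1, h2, h3, h4⟩ := hK.exists_rectangle
    rw [← coe_sites] at hu hw
    refine ⟨(u, w), Finset.mem_product.2 ⟨hu, hw⟩, ?_⟩
    have hF := hK.spanned u w hR
    have hw1 : w.1 - u.1 < (2 * k + 2 * b : ℕ) := by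
      obtain ⟨z, hz, hzu⟩ := h1
      obtain ⟨z', hz', hzw⟩ := h2
      have := (hsmall z' hz' z hz).1
      omega
    have hw2 : w.2 - u.2 < (2 * h + 2 * b : ℕ) := by
      obtain ⟨z, hz, hzu⟩ := h3
      obtain ⟨z', hz', hzw⟩ := h4
      have := (hsmall z' hz' z hz).2
      omega
    have hbig' : u.1 + k ≤ w.1 ∨ u.2 + h ≤ w.2 := by
      by_contra! hcon
      refine hbig fun z hz z' hz' => ?_
      have e1 := hR hz
      have e2 := hR hz'
      simp only [Set.mem_Icc, Prod.le_def] at e1 e2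
      omega
    rcases hbig' with hb | hb
    · refine Or.inl ⟨hw2, fun i hi => ?_⟩
      refine hasCluster_vstrip ha hab hK.linked hR hF h1 h2 ?_ (hdiv hi hb)
      have : (0 : ℤ) ≤ i * m := by positivity
      simp only []
      omega
    · refine Or.inr ⟨hw1, fun i hi => ?_⟩
      refine hasCluster_hstrip ha hab hK.linked hR hF h3 h4 ?_ (hdiv hi hb)
      have : (0 : ℤ) ≤ i * m := by positivity
      simp only []
      omega
  · have hE : ∀ z ∈ sites L ×ˢ sites L, bprob p (sites L) (E z) ≤ X + Y := by
      intro z hz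
      rw [Finset.mem_product] at hz
      have hemp : bprob p (sites L) (∅ : Set (Finset (ℤ × ℤ))) = 0 := by
        rw [bprob, Set.indicator_empty]; exact bexp_const p _ 0
      refine (bprob_le_add hp0 hp1 (E₁ := {S | z.2.2 - z.1.2 < (2 * h + 2 * b : ℕ) ∧
        ∀ i < k / m, HasCluster b (b ^ 2) (vstrip z.1 z.2 m (z.1.1 + i * m)) S})
        (E₂ := {S | z.2.1 - z.1.1 < (2 * k + 2 * b : ℕ) ∧
        ∀ i < h / m, HasCluster a (b ^ 2) (hstrip z.1 z.2 m (z.1.2 + i * m)) S})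
        fun S _ h => h).trans (add_le_add ?_ ?_)
      · by_cases hlt : z.2.2 - z.1.2 < (2 * h + 2 * b : ℕ)
        · exact (bprob_mono hp0 hp1 fun S _ h => h.2).trans
            (bprob_vstrips_le hp0 hp1 hz.1 hz.2 hlt)
        · exact (bprob_mono hp0 hp1 (E' := ∅) fun S _ h => (hlt h.1).elim).trans (hemp ▸ hX0)
      · by_cases hlt : z.2.1 - z.1.1 < (2 * k + 2 * b : ℕ)
        · exact (bprob_mono hp0 hp1 fun S _ h => h.2).trans
            (bprob_hstrips_le hp0 hp1 hC hz.1 hz.2 hlt)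
        · exact (bprob_mono hp0 hp1 (E' := ∅) fun S _ h => (hlt h.1).elim).trans (hemp ▸ hY0)
    refine (Finset.sum_le_card_nsmul _ _ _ hE).trans (le_of_eq ?_)
    rw [nsmul_eq_mul, Finset.card_product, card_sites]
    push_cast
    ring

/-- Unit steps towards `c`, with induction on the ℓ¹-distance. -/
theorem square_linked (hb : 1 ≤ b) (L : ℕ) : Linked b (square L) := by
  intro T hT hne hTK
  by_contra! hcon
  obtain ⟨t, ht⟩ := hne
  have hcon' : ∀ t ∈ T, ∀ c ∈ square L, Near b t c → c ∈ T := fun t ht c hc hn => by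
    by_contra h; exact hcon t ht c hc h hn
  have hx : ∀ n : ℕ, ∀ t ∈ T, ∀ c ∈ square L, (t.1 - c.1).natAbs + (t.2 - c.2).natAbs = n → c ∈ T := by
    intro n
    induction n with
    | zero =>
      intro t ht c hc h
      have : t = c := Prod.ext (by omega) (by omega)
      exact this ▸ ht
    | succ n ih =>
      intro t ht c hc h
      have htS := mem_square.1 (hT ht)
      have hcS := mem_square.1 hc
      have step : ∀ d : ℤ × ℤ, d ∈ square L → Near b t d →
          (d.1 - c.1).natAbs + (d.2 - c.2).natAbs = n → c ∈ T := fun d hd hn hdn =>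
        ih d (hcon' t ht d hd hn) c hc hdn
      rcases lt_trichotomy t.1 c.1 with h1 | h1 | h1
      · refine step (t.1 + 1, t.2) (mem_square.2 (by simp only []; omega)) ?_ ?_
        · simp only [Near, abs_le]; omega
        · simp only []; omega
      · rcases lt_trichotomy t.2 c.2 with h2 | h2 | h2
        · refine step (t.1, t.2 + 1) (mem_square.2 (by simp only []; omega)) ?_ ?_
          · simp only [Near, abs_le]; omega
          · simp only []; omega
        · simp [h1, h2] at h
        · refine step (t.1, t.2 - 1) (mem_square.2 (by simp only []; omega)) ?_ ?_
          · simp only [Near, abs_le]; omega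
          · simp only []; omega
      · refine step (t.1 - 1, t.2) (mem_square.2 (by simp only []; omega)) ?_ ?_
        · simp only [Near, abs_le]; omega
        · simp only []; omega
  exact hTK (Set.Subset.antisymm hT fun c hc => hx _ t ht c hc rfl)

/-- Covers squares too small for the droplet lemma. One vertical strip across the square must
contain a cluster of `b` sites; if not even one strip fits, some site must be initially occupied. -/
theorem bprob_spanned_le_of_small (ha : 1 ≤ a) (hab : a < b) {p : ℝ} (hp0 : 0 ≤ p) (hp1 : p ≤ 1)
    (L : ℕ) : bprob p (sites L) {S | square L ⊆ finalConfig a b (square L) S} ≤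
      stripWidth b * (L + 1) * (ballSubsets (b ^ 2) * p ^ b) + stripWidth b ^ 2 * p := by
  set m := stripWidth b with hm
  by_cases hL : m ≤ L + 1
  · have h0 : (0 : ℤ × ℤ) ∈ sites L := mem_sites.2 (by simp)
    have h1 : ((L, L) : ℤ × ℤ) ∈ sites L := mem_sites.2 (by simp)
    have hI : Set.Icc (0 : ℤ × ℤ) (L, L) = square L := by
      ext v; rw [mem_square]; simp only [Set.mem_Icc, Prod.le_def, Prod.fst_zero, Prod.snd_zero]
      omega
    have hle := bprob_vstrips_le hp0 hp1 (r := b) (M := b ^ 2) (m := m) (N := 1) h0 h1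
      (H := L + 1) (by simp)
    rw [pow_one] at hle
    have h3 : 0 ≤ (m : ℝ) ^ 2 * p := by positivity
    refine le_trans (bprob_mono hp0 hp1 fun S hS hspan => ?_) (hle.trans ?_)
    · intro i hi
      obtain rfl : i = 0 := by omega
      have hS' : (S : Set (ℤ × ℤ)) ⊆ square L := by
        rw [← coe_sites]; exact_mod_cast hS
      refine hasCluster_vstrip ha hab (K := square L) (square_linked (by omega) L) hI.ge ?_
        ⟨0, mem_square.2 (by simp), rfl⟩ ⟨(L, L), mem_square.2 (by simp), rfl⟩ (by simp) ?_
      · rw [hI, Set.inter_eq_left.2 hS']; exact hspan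
      · simp; omega
    · push_cast
      linarith
  · have h1 : bprob p (sites L) {S | square L ⊆ finalConfig a b (square L) S} ≤
        ∑ v ∈ sites L, bprob p (sites L) {S | {v} ⊆ S} := by
      refine bprob_le_sum hp0 hp1 _ _ fun S hS hspan => ?_
      have hne : S.Nonempty := by
        by_contra hcon
        rw [Finset.not_nonempty_iff_eq_empty] at hcon
        subst hcon
        have : finalConfig a b (square L) ((∅ : Finset (ℤ × ℤ)) : Set (ℤ × ℤ)) ⊆ ∅ :=
          finalConfig_subset (by simp) fun v _ h => by simp at h; omega
        exact this (hspan (mem_square.2 (by simp) : ((0, 0) : ℤ × ℤ) ∈ square L))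
      obtain ⟨v, hv⟩ := hne
      exact ⟨v, hS hv, by simpa using hv⟩
    have h2 : ∀ v ∈ sites L, bprob p (sites L) {S | {v} ⊆ S} = p := fun v hv => by
      rw [bprob_superset p (by simpa using hv)]; simp
    rw [Finset.sum_congr rfl h2, Finset.sum_const, nsmul_eq_mul, card_sites] at h1
    have h3 : ((L : ℝ) + 1) ^ 2 ≤ (m : ℝ) ^ 2 := by
      have : (L : ℝ) + 1 ≤ m := by exact_mod_cast (by omega : L + 1 ≤ m)
      gcongr
    have h4 : 0 ≤ (m : ℝ) * (L + 1) * (ballSubsets (b ^ 2) * p ^ b) := by positivity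
    push_cast at h1
    nlinarith

end ClusterBounds

/-! ### Growth of a seed inside a box. -/

section Growth

variable {a b : ℕ}

/-- `F` is stable under the dynamics in `D`. -/
def Stable (a b : ℕ) (D F : Set (ℤ × ℤ)) : Prop :=
  ∀ v ∈ D, a + b ≤ (neighborhood a b v ∩ F).ncard → v ∈ F

theorem finalConfig_stable (D A : Set (ℤ × ℤ)) : Stable a b D (finalConfig a b D A) :=
  fun _ hv h => mem_finalConfig_of_le hv h

/-- One horizontal arm of length `a` and one vertical arm of length `b` reach the threshold exactly.
All the growth steps use this one pattern. -/
theorem Stable.mem_of_quarter {D F : Set (ℤ × ℤ)} (hF : Stable a b D F) {x y σ τ : ℤ}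
    (hv : (x, y) ∈ D) (hσ : σ = 1 ∨ σ = -1) (hτ : τ = 1 ∨ τ = -1)
    (hx : ∀ i : ℤ, 1 ≤ i → i ≤ a → (x + σ * i, y) ∈ F)
    (hy : ∀ j : ℤ, 1 ≤ j → j ≤ b → (x, y + τ * j) ∈ F) : (x, y) ∈ F := by
  refine hF _ hv ?_
  set T₁ : Finset (ℤ × ℤ) := (Finset.Icc (1 : ℤ) a).image fun i => (x + σ * i, y) with hT₁
  set T₂ : Finset (ℤ × ℤ) := (Finset.Icc (1 : ℤ) b).image fun j => (x, y + τ * j) with hT₂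
  have h1 : T₁.card = a := by
    rw [hT₁, Finset.card_image_of_injective]
    · simp
    · intro i j h
      simp only [Prod.mk.injEq] at h
      rcases hσ with rfl | rfl <;> omega
  have h2 : T₂.card = b := by
    rw [hT₂, Finset.card_image_of_injective]
    · simp
    · intro i j h
      simp only [Prod.mk.injEq] at h
      rcases hτ with rfl | rfl <;> omega
  have hdis : Disjoint T₁ T₂ := by
    rw [Finset.disjoint_left]
    intro w hw hw'
    simp only [hT₁, hT₂, Finset.mem_image, Finset.mem_Icc] at hw hw'
    obtain ⟨i, hi, rfl⟩ := hw
    obtain ⟨j, hj, h⟩ := hw'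
    simp only [Prod.mk.injEq] at h
    rcases hσ with rfl | rfl <;> omega
  have hsub : ((T₁ ∪ T₂ : Finset (ℤ × ℤ)) : Set (ℤ × ℤ)) ⊆ neighborhood a b (x, y) ∩ F := by
    intro w hw
    simp only [hT₁, hT₂, Finset.coe_union, Set.mem_union, Finset.mem_coe, Finset.mem_image,
      Finset.mem_Icc] at hw
    rcases hw with ⟨i, hi, rfl⟩ | ⟨j, hj, rfl⟩
    · refine ⟨⟨?_, Or.inl ⟨rfl, ?_⟩⟩, hx i hi.1 hi.2⟩
      · simp only [ne_eq, Prod.mk.injEq, not_and]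
        rcases hσ with rfl | rfl <;> omega
      · simp only [abs_le]
        rcases hσ with rfl | rfl <;> omega
    · refine ⟨⟨?_, Or.inr ⟨rfl, ?_⟩⟩, hy j hj.1 hj.2⟩
      · simp only [ne_eq, Prod.mk.injEq, not_and]
        rcases hτ with rfl | rfl <;> omega
      · simp only [abs_le]
        rcases hτ with rfl | rfl <;> omega
  have h3 := Set.ncard_le_ncard hsub ((neighborhood_finite a b _).subset Set.inter_subset_left)
  rwa [Set.ncard_coe_finset, Finset.card_union_of_disjoint hdis, h1, h2] at h3

theorem fill_interval {P : ℤ → Prop} {r : ℕ} {y₀ y₁ t : ℤ} (h0 : y₀ ≤ t) (h1 : t ≤ y₁)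
    (hrun : ∀ y, t ≤ y → y < t + r → P y)
    (hup : ∀ y, y₀ ≤ y → y < y₁ → (∀ j : ℤ, 1 ≤ j → j ≤ r → P (y - j)) → P y)
    (hdown : ∀ y, y₀ ≤ y → y < y₁ → (∀ j : ℤ, 1 ≤ j → j ≤ r → P (y + j)) → P y) :
    ∀ y, y₀ ≤ y → y < y₁ → P y := by
  have up : ∀ n : ℕ, ∀ y, t ≤ y → y < t + r + n → y < y₁ → P y := by
    intro n
    induction n with
    | zero => intro y h1 h2 _; exact hrun y h1 (by omega)
    | succ n ih =>
      intro y h1 h2 h3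
      by_cases h : y < t + r + n
      · exact ih y h1 h h3
      · exact hup y (by omega) h3 fun j hj hj' => ih _ (by omega) (by omega) (by omega)
  have down : ∀ n : ℕ, ∀ y, t - n ≤ y → y < t → y₀ ≤ y → P y := by
    intro n
    induction n with
    | zero => intro y h2 h3 _; omega
    | succ n ih =>
      intro y h2 h3 h4
      refine hdown y h4 (by omega) fun j hj hj' => ?_
      by_cases hyj : y + j < t
      · exact ih _ (by omega) hyj (by omega)
      · exact hrun _ (by omega) (by omega)
  intro y h2 h3
  by_cases hy : y < t
  · exact down (t - y).toNat y (by omega) hy h2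
  · exact up ((y - t).toNat + 1) y (by omega) (by push_cast; omega) h3

/-- The full side supplies `a` neighbours, so a run of `b` sites spreads along the column in both
directions. -/
theorem Stable.fill_column {D F : Set (ℤ × ℤ)} (hF : Stable a b D F) {x y₀ y₁ t σ : ℤ}
    (hσ : σ = 1 ∨ σ = -1) (hD : ∀ y, y₀ ≤ y → y < y₁ → (x, y) ∈ D)
    (hside : ∀ y, y₀ ≤ y → y < y₁ → ∀ i : ℤ, 1 ≤ i → i ≤ a → (x + σ * i, y) ∈ F) (h0 : y₀ ≤ t)
    (h1 : t ≤ y₁) (hrun : ∀ y, t ≤ y → y < t + b → (x, y) ∈ F) : ∀ y, y₀ ≤ y → y < y₁ → (x, y) ∈ F := by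
  refine fill_interval (P := fun y => (x, y) ∈ F) h0 h1 hrun (fun y h1 h2 h => ?_)
    (fun y h1 h2 h => ?_)
  · refine hF.mem_of_quarter (hD y h1 h2) hσ (Or.inr rfl) (hside y h1 h2) fun j hj hj' => ?_
    have := h j hj hj'
    rwa [show y + -1 * j = y - j by ring]
  · refine hF.mem_of_quarter (hD y h1 h2) hσ (Or.inl rfl) (hside y h1 h2) fun j hj hj' => ?_
    have := h j hj hj'
    rwa [one_mul]

theorem Stable.fill_row {D F : Set (ℤ × ℤ)} (hF : Stable a b D F) {y x₀ x₁ t : ℤ}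
    (hD : ∀ x, x₀ ≤ x → x < x₁ → (x, y) ∈ D)
    (hside : ∀ x, x₀ ≤ x → x < x₁ → ∀ j : ℤ, 1 ≤ j → j ≤ b → (x, y - j) ∈ F) (h0 : x₀ ≤ t)
    (h1 : t ≤ x₁) (hrun : ∀ x, t ≤ x → x < t + a → (x, y) ∈ F) : ∀ x, x₀ ≤ x → x < x₁ → (x, y) ∈ F := by
  have hside' : ∀ x, x₀ ≤ x → x < x₁ → ∀ j : ℤ, 1 ≤ j → j ≤ b → (x, y + -1 * j) ∈ F := by
    intro x h1 h2 j hj hj'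
    rw [show y + -1 * j = y - j by ring]
    exact hside x h1 h2 j hj hj'
  refine fill_interval (P := fun x => (x, y) ∈ F) h0 h1 hrun (fun x h1 h2 h => ?_)
    (fun x h1 h2 h => ?_)
  · refine hF.mem_of_quarter (hD x h1 h2) (Or.inr rfl) (Or.inr rfl) (fun j hj hj' => ?_)
      (hside' x h1 h2)
    have := h j hj hj'
    rwa [show x + -1 * j = x - j by ring]
  · refine hF.mem_of_quarter (hD x h1 h2) (Or.inl rfl) (Or.inr rfl) (fun j hj hj' => ?_)
      (hside' x h1 h2)
    have := h j hj hj'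
    rwa [one_mul]

/-- The `r` consecutive sites to the right of `(x, y)`, inclusive. -/
noncomputable def hblock (r : ℕ) (x y : ℤ) : Finset (ℤ × ℤ) := Finset.Ico x (x + r) ×ˢ {y}

/-- The `r` consecutive sites above `(x, y)`, inclusive. -/
noncomputable def vblock (r : ℕ) (x y : ℤ) : Finset (ℤ × ℤ) := {x} ×ˢ Finset.Ico y (y + r)

theorem card_hblock (r : ℕ) (x y : ℤ) : (hblock r x y).card = r := by simp [hblock]

theorem card_vblock (r : ℕ) (x y : ℤ) : (vblock r x y).card = r := by simp [vblock]

theorem mem_hblock {r : ℕ} {x y : ℤ} {v : ℤ × ℤ} :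
    v ∈ hblock r x y ↔ (x ≤ v.1 ∧ v.1 < x + r) ∧ v.2 = y := by
  simp only [hblock, Finset.mem_product, Finset.mem_Ico, Finset.mem_singleton]

theorem mem_vblock {r : ℕ} {x y : ℤ} {v : ℤ × ℤ} :
    v ∈ vblock r x y ↔ v.1 = x ∧ y ≤ v.2 ∧ v.2 < y + r := by
  simp only [vblock, Finset.mem_product, Finset.mem_Ico, Finset.mem_singleton]

/-- The configurations that contain one of the `n / r` consecutive blocks of `r` sites that fit into
the horizontal segment of length `n` starting at `(x, y)`. -/
def hrun (r n : ℕ) (x y : ℤ) : Set (Finset (ℤ × ℤ)) :=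
  {S | ∃ i < n / r, hblock r (x + i * r) y ⊆ S}

/-- The configurations that contain one of the `n / r` consecutive blocks of `r` sites that fit into
the vertical segment of length `n` starting at `(x, y)`. -/
def vrun (r n : ℕ) (x y : ℤ) : Set (Finset (ℤ × ℤ)) :=
  {S | ∃ i < n / r, vblock r x (y + i * r) ⊆ S}

theorem isUpperSet_hrun (r n : ℕ) (x y : ℤ) : IsUpperSet (hrun r n x y) :=
  fun _ _ h ⟨i, hi, hS⟩ => ⟨i, hi, hS.trans h⟩

theorem isUpperSet_vrun (r n : ℕ) (x y : ℤ) : IsUpperSet (vrun r n x y) :=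
  fun _ _ h ⟨i, hi, hS⟩ => ⟨i, hi, hS.trans h⟩

/-- Only disjoint blocks are tested, so that their failures are independent; this loses just a
constant factor in the exponent. -/
theorem bprob_forall_not_subset {p : ℝ} {F : Finset (ℤ × ℤ)} {r N : ℕ} (T : ℕ → Finset (ℤ × ℤ))
    (hT : ∀ i < N, T i ⊆ F) (hd : ((Finset.range N : Finset ℕ) : Set ℕ).PairwiseDisjoint T)
    (hc : ∀ i, (T i).card = r) : bprob p F {S | ∃ i < N, T i ⊆ S}ᶜ = (1 - p ^ r) ^ N := by
  have e : {S : Finset (ℤ × ℤ) | ∃ i < N, T i ⊆ S}ᶜ =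
      {S | ∀ i ∈ Finset.range N, S ∩ T i ∈ {S | T i ⊆ S}ᶜ} := by
    ext S
    simp [Finset.subset_inter_iff]
  rw [e, bprob_forall_of_pairwiseDisjoint p (Finset.range N) T
    (fun i hi => hT i (Finset.mem_range.1 hi)) hd (fun i => {S | T i ⊆ S}ᶜ)]
  have h1 : ∀ i ∈ Finset.range N, bprob p (T i) {S | T i ⊆ S}ᶜ = 1 - p ^ r := fun i _ => by
    rw [bprob_compl, bprob_superset p (Finset.Subset.refl _), hc]
  rw [Finset.prod_congr rfl h1, Finset.prod_const, Finset.card_range]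

theorem add_mul_add_le {i n r : ℕ} {x : ℤ} (h : i < n / r) : x + i * r + r ≤ x + n := by
  have h1 : (i + 1) * r ≤ n := (Nat.mul_le_mul_right r h).trans (Nat.div_mul_le_self n r)
  have h2 : ((i : ℤ) + 1) * r ≤ n := by exact_mod_cast h1
  linarith

theorem bprob_compl_hrun {p : ℝ} {F : Finset (ℤ × ℤ)} {r n : ℕ} {x y : ℤ}
    (hF : hblock n x y ⊆ F) : bprob p F (hrun r n x y)ᶜ = (1 - p ^ r) ^ (n / r) := by
  refine bprob_forall_not_subset _ (fun i hi v hv => hF ?_) (fun i _ j _ hij => ?_)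
    (fun i => card_hblock _ _ _)
  · rw [mem_hblock] at *
    have h1 := add_mul_add_le (x := x) hi
    have h2 : (0 : ℤ) ≤ i * r := by positivity
    omega
  · refine Finset.disjoint_left.2 fun v hv hv' => hij ?_
    rw [mem_hblock] at hv hv'
    exact le_antisymm (add_mul_le_of_lt hv'.1.2 hv.1.1) (add_mul_le_of_lt hv.1.2 hv'.1.1)

theorem bprob_compl_vrun {p : ℝ} {F : Finset (ℤ × ℤ)} {r n : ℕ} {x y : ℤ}
    (hF : vblock n x y ⊆ F) : bprob p F (vrun r n x y)ᶜ = (1 - p ^ r) ^ (n / r) := by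
  refine bprob_forall_not_subset _ (fun i hi v hv => hF ?_) (fun i _ j _ hij => ?_)
    (fun i => card_vblock _ _ _)
  · rw [mem_vblock] at *
    have h1 := add_mul_add_le (x := y) hi
    have h2 : (0 : ℤ) ≤ i * r := by positivity
    omega
  · refine Finset.disjoint_left.2 fun v hv hv' => hij ?_
    rw [mem_vblock] at hv hv'
    exact le_antisymm (add_mul_le_of_lt hv'.2.2 hv.2.1) (add_mul_le_of_lt hv.2.2 hv'.2.1)

theorem Stable.fill_column_of_vrun {D F : Set (ℤ × ℤ)} (hF : Stable a b D F)
    {S : Finset (ℤ × ℤ)} (hS : (S : Set (ℤ × ℤ)) ⊆ F) {x y₀ y₁ σ : ℤ} {n : ℕ}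
    (hσ : σ = 1 ∨ σ = -1) (hD : ∀ y, y₀ ≤ y → y < y₁ → (x, y) ∈ D)
    (hside : ∀ y, y₀ ≤ y → y < y₁ → ∀ i : ℤ, 1 ≤ i → i ≤ a → (x + σ * i, y) ∈ F)
    (hn : y₀ + n ≤ y₁) (hrun : S ∈ vrun b n x y₀) : ∀ y, y₀ ≤ y → y < y₁ → (x, y) ∈ F := by
  obtain ⟨i, hin, hi⟩ := hrun
  have := add_mul_add_le (x := y₀) hin
  have : (0 : ℤ) ≤ i * b := by positivity
  exact hF.fill_column hσ hD hside (t := y₀ + i * b) (by omega) (by omega)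
    fun y h1 h2 => hS (hi (mem_vblock.2 ⟨rfl, h1, h2⟩))

theorem Stable.fill_row_of_hrun {D F : Set (ℤ × ℤ)} (hF : Stable a b D F)
    {S : Finset (ℤ × ℤ)} (hS : (S : Set (ℤ × ℤ)) ⊆ F) {y x₀ x₁ : ℤ} {n : ℕ}
    (hD : ∀ x, x₀ ≤ x → x < x₁ → (x, y) ∈ D)
    (hside : ∀ x, x₀ ≤ x → x < x₁ → ∀ j : ℤ, 1 ≤ j → j ≤ b → (x, y - j) ∈ F)
    (hn : x₀ + n ≤ x₁) (hrun : S ∈ hrun a n x₀ y) : ∀ x, x₀ ≤ x → x < x₁ → (x, y) ∈ F := by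
  obtain ⟨i, hin, hi⟩ := hrun
  have := add_mul_add_le (x := x₀) hin
  have : (0 : ℤ) ≤ i * a := by positivity
  exact hF.fill_row hD hside (t := x₀ + i * a) (by omega) (by omega)
    fun x h1 h2 => hS (hi (mem_hblock.2 ⟨⟨h1, h2⟩, rfl⟩))

/-- Once a rectangle of width `w` and height `b` at `(x₀, 0)` is full, it grows to a full square of
side `M` in the configurations of this event. -/
def growthEvent (a b w H M : ℕ) (x₀ : ℤ) : Set (Finset (ℤ × ℤ)) :=
  {S | (∀ y ∈ Finset.Ico b H, S ∈ hrun a w x₀ y) ∧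
    (∀ n ∈ Finset.range H, S ∈ vrun b H (x₀ + n) 0) ∧
    (∀ n ∈ Finset.Ico H M, S ∈ vrun b n (x₀ + n) 0) ∧
    ∀ n ∈ Finset.Ico H M, S ∈ hrun a n x₀ n}

/-- The sites of the rectangle of width `w` and height `h` with lower left corner `(x₀, 0)`. -/
noncomputable def rect (w h : ℕ) (x₀ : ℤ) : Finset (ℤ × ℤ) := Finset.Ico x₀ (x₀ + w) ×ˢ Finset.Ico 0 (h : ℤ)

theorem mem_rect {w h : ℕ} {x₀ : ℤ} {v : ℤ × ℤ} :
    v ∈ rect w h x₀ ↔ (x₀ ≤ v.1 ∧ v.1 < x₀ + w) ∧ 0 ≤ v.2 ∧ v.2 < h := by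
  simp only [rect, Finset.mem_product, Finset.mem_Ico]

theorem card_rect (w h : ℕ) (x₀ : ℤ) : (rect w h x₀).card = w * h := by simp [rect]

/-- Three stages, one for each type of line in the event: the seed rises row by row to height `H`,
the tower widens column by column to side `H`, and the square grows by one column and one row at a
time. -/
theorem Stable.rect_subset {D F : Set (ℤ × ℤ)} (hF : Stable a b D F) {S : Finset (ℤ × ℤ)}
    (hS : (S : Set (ℤ × ℤ)) ⊆ F) {w H M : ℕ} {x₀ : ℤ} (haw : a ≤ w) (hwH : w ≤ H) (hbH : b ≤ H)
    (hHM : H ≤ M) (hD : ∀ v ∈ rect M M x₀, v ∈ D) (hseed : rect w b x₀ ⊆ S)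
    (hgrow : S ∈ growthEvent a b w H M x₀) : ∀ v ∈ rect M M x₀, v ∈ F := by
  obtain ⟨hr, hc, hc', hr'⟩ := hgrow
  have hD' : ∀ x y : ℤ, x₀ ≤ x → x < x₀ + M → 0 ≤ y → y < M → (x, y) ∈ D :=
    fun x y h1 h2 h3 h4 => hD _ (mem_rect.2 ⟨⟨h1, h2⟩, h3, h4⟩)
  have rows : ∀ n : ℕ, n ≤ H → ∀ x y : ℤ, x₀ ≤ x → x < x₀ + w → 0 ≤ y → y < n → (x, y) ∈ F := by
    intro n
    induction n with
    | zero => intro _ x y _ _ _ _; omega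
    | succ n ih =>
      intro hn x y h1 h2 h3 h4
      by_cases hy : y < n
      · exact ih (by omega) x y h1 h2 h3 hy
      · by_cases hyb : y < b
        · exact hS (hseed (mem_rect.2 ⟨⟨h1, h2⟩, h3, hyb⟩))
        · obtain rfl : y = n := by omega
          refine hF.fill_row_of_hrun hS (fun x h1 h2 => hD' _ _ h1 (by omega) (by omega) (by omega))
            (fun x h1 h2 j hj hj' => ih (by omega) _ _ h1 h2 (by omega) (by omega))
            (by omega) (hr n (Finset.mem_Ico.2 ⟨by omega, by omega⟩)) x h1 h2
  have cols : ∀ n : ℕ, n ≤ H → ∀ x y : ℤ, x₀ ≤ x → x < x₀ + n → 0 ≤ y → y < H → (x, y) ∈ F := by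
    intro n
    induction n with
    | zero => intro _ x y _ _ _ _; omega
    | succ n ih =>
      intro hn x y h1 h2 h3 h4
      by_cases hxw : x < x₀ + w
      · exact rows H le_rfl x y h1 hxw h3 h4
      · by_cases hx : x < x₀ + n
        · exact ih (by omega) x y h1 hx h3 h4
        · obtain rfl : x = x₀ + n := by omega
          exact hF.fill_column_of_vrun hS (Or.inr rfl)
            (fun y h1 h2 => hD' _ _ (by omega) (by omega) h1 (by omega))
            (fun y h1 h2 i hi hi' => ih (by omega) _ _ (by omega) (by omega) h1 h2)
            (by omega) (hc n (Finset.mem_range.2 (by omega))) y h3 h4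
  have squares : ∀ n : ℕ, n ≤ M → ∀ x y : ℤ, x₀ ≤ x → x < x₀ + n → 0 ≤ y → y < n → (x, y) ∈ F := by
    intro n
    induction n with
    | zero => intro _ x y _ _ _ _; omega
    | succ n ih =>
      intro hn
      by_cases hnH : n < H
      · intro x y h1 h2 h3 h4
        exact cols H le_rfl x y h1 (by omega) h3 (by omega)
      · have ih' := ih (by omega)
        have hmem : n ∈ Finset.Ico H M := Finset.mem_Ico.2 ⟨by omega, by omega⟩
        have hcol : ∀ y : ℤ, 0 ≤ y → y < n → (x₀ + n, y) ∈ F := by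
          exact hF.fill_column_of_vrun hS (Or.inr rfl)
            (fun y h1 h2 => hD' _ _ (by omega) (by omega) h1 (by omega))
            (fun y h1 h2 i hi hi' => ih' _ _ (by omega) (by omega) h1 h2) (by omega) (hc' n hmem)
        have hrow : ∀ x : ℤ, x₀ ≤ x → x < x₀ + n → (x, (n : ℤ)) ∈ F := by
          exact hF.fill_row_of_hrun hS
            (fun x h1 h2 => hD' _ _ h1 (by omega) (by omega) (by omega))
            (fun x h1 h2 j hj hj' => ih' _ _ h1 h2 (by omega) (by omega)) (by omega) (hr' n hmem)
        -- The corner has its arms in the row and the column just filled; `a ≤ n` and `b ≤ n` hold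
        -- because `n ≥ H`.
        have hcorner : (x₀ + n, (n : ℤ)) ∈ F :=
          hF.mem_of_quarter (hD' _ _ (by omega) (by omega) (by omega) (by omega)) (Or.inr rfl)
            (Or.inr rfl) (fun i hi hi' => hrow _ (by omega) (by omega))
            (fun j hj hj' => hcol _ (by omega) (by omega))
        intro x y h1 h2 h3 h4
        by_cases hx : x < x₀ + n
        · by_cases hy : y < n
          · exact ih' x y h1 hx h3 hy
          · obtain rfl : y = n := by omega
            exact hrow x h1 hx
        · obtain rfl : x = x₀ + n := by omega
          by_cases hy : y < n
          · exact hcol y h3 hy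
          · obtain rfl : y = n := by omega
            exact hcorner
  rintro ⟨x, y⟩ hv
  rw [mem_rect] at hv
  exact squares M le_rfl x y hv.1.1 hv.1.2 hv.2.1 hv.2.2

theorem isUpperSet_growthEvent (a b w H M : ℕ) (x₀ : ℤ) :
    IsUpperSet (growthEvent a b w H M x₀) :=
  fun _ _ h ⟨h1, h2, h3, h4⟩ => ⟨fun y hy => isUpperSet_hrun _ _ _ _ h (h1 y hy),
    fun n hn => isUpperSet_vrun _ _ _ _ h (h2 n hn), fun n hn => isUpperSet_vrun _ _ _ _ h (h3 n hn),
    fun n hn => isUpperSet_hrun _ _ _ _ h (h4 n hn)⟩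

theorem bprob_not_forall_le {ι : Type*} {p : ℝ} (hp0 : 0 ≤ p) (hp1 : p ≤ 1) {F : Finset (ℤ × ℤ)}
    (I : Finset ι) (E : ι → Set (Finset (ℤ × ℤ))) :
    bprob p F {S | ∀ i ∈ I, S ∈ E i}ᶜ ≤ ∑ i ∈ I, bprob p F (E i)ᶜ :=
  bprob_le_sum hp0 hp1 I _ fun S _ hS => by simpa using hS

theorem bprob_compl_growthEvent_le {p : ℝ} (hp0 : 0 ≤ p) (hp1 : p ≤ 1) {w H M : ℕ} (hwH : w ≤ H)
    (hHM : H ≤ M) (x₀ : ℤ) :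
    bprob p (rect M M x₀) (growthEvent a b w H M x₀)ᶜ ≤
      H * (1 - p ^ a) ^ (w / a) + H * (1 - p ^ b) ^ (H / b) +
      (∑ n ∈ Finset.Ico H M, (1 - p ^ b) ^ (n / b) +
        ∑ n ∈ Finset.Ico H M, (1 - p ^ a) ^ (n / a)) := by
  set F := rect M M x₀ with hF
  have hh : ∀ n y : ℕ, n ≤ M → y < M → hblock n x₀ y ⊆ F := fun n y hn hy v hv => by
    rw [mem_hblock] at hv
    rw [hF, mem_rect]
    omega
  have hv : ∀ n m : ℕ, n ≤ M → m < M → vblock n (x₀ + m) 0 ⊆ F := fun n m hn hm v hv => by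
    rw [mem_vblock] at hv
    rw [hF, mem_rect]
    omega
  have e : growthEvent a b w H M x₀ =
      ({S | ∀ y ∈ Finset.Ico b H, S ∈ hrun a w x₀ (y : ℕ)} ∩
        {S | ∀ n ∈ Finset.range H, S ∈ vrun b H (x₀ + (n : ℕ)) 0}) ∩
      ({S | ∀ n ∈ Finset.Ico H M, S ∈ vrun b n (x₀ + (n : ℕ)) 0} ∩
        {S | ∀ n ∈ Finset.Ico H M, S ∈ hrun a n x₀ (n : ℕ)}) := by
    ext S
    simp only [growthEvent, Set.mem_ofPred_eq, Set.mem_inter_iff, and_assoc]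
  have hcompl : ∀ E E' : Set (Finset (ℤ × ℤ)),
      bprob p F (E ∩ E')ᶜ ≤ bprob p F Eᶜ + bprob p F E'ᶜ := fun E E' =>
    bprob_le_add hp0 hp1 fun S _ h => by
      rw [Set.compl_inter] at h; exact h
  have hpa : p ^ a ≤ 1 := pow_le_one₀ hp0 hp1
  have hpb : p ^ b ≤ 1 := pow_le_one₀ hp0 hp1
  rw [e]
  refine (hcompl _ _).trans (add_le_add ((hcompl _ _).trans (add_le_add ?_ ?_))
    ((hcompl _ _).trans (add_le_add ?_ ?_))) <;>
    refine (bprob_not_forall_le hp0 hp1 _ _).trans ?_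
  · refine (Finset.sum_le_card_nsmul _ _ ((1 - p ^ a) ^ (w / a)) fun y hy => ?_).trans ?_
    · rw [Finset.mem_Ico] at hy
      exact (bprob_compl_hrun (hh w y (by omega) (by omega))).le
    · rw [nsmul_eq_mul, Nat.card_Ico]
      refine mul_le_mul_of_nonneg_right ?_ (pow_nonneg (by linarith) _)
      exact_mod_cast Nat.sub_le _ _
  · refine (Finset.sum_le_card_nsmul _ _ ((1 - p ^ b) ^ (H / b)) fun y hy => ?_).trans ?_
    · rw [Finset.mem_range] at hy
      exact (bprob_compl_vrun (hv H y (by omega) (by omega))).le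
    · rw [nsmul_eq_mul, Finset.card_range]
  · refine Finset.sum_le_sum fun n hn => ?_
    rw [Finset.mem_Ico] at hn
    exact (bprob_compl_vrun (hv n n (by omega) (by omega))).le
  · refine Finset.sum_le_sum fun n hn => ?_
    rw [Finset.mem_Ico] at hn
    exact (bprob_compl_hrun (hh n n (by omega) (by omega))).le

/-- The lower bound on the probability that a given box contains a seed that fills the box. -/
theorem le_bprob_seed {p : ℝ} (hp0 : 0 ≤ p) (hp1 : p ≤ 1) {w H M : ℕ} (hwM : w ≤ M) (hbM : b ≤ M)
    (x₀ : ℤ) {ε : ℝ} (hε : bprob p (rect M M x₀) (growthEvent a b w H M x₀)ᶜ ≤ ε) :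
    p ^ (w * b) * (1 - ε) ≤
      bprob p (rect M M x₀) ({S | rect w b x₀ ⊆ S} ∩ growthEvent a b w H M x₀) := by
  have hsub : rect w b x₀ ⊆ rect M M x₀ := fun v hv => by
    rw [mem_rect] at *
    omega
  -- Seed and growth are both increasing events, so Harris' inequality spares a check that they are
  -- independent.
  refine le_trans ?_ (bprob_mul_le_of_isUpperSet hp0 hp1 _ (fun S T h hS => hS.trans h)
    (isUpperSet_growthEvent a b w H M x₀))
  rw [bprob_superset p hsub, card_rect]
  refine mul_le_mul_of_nonneg_left ?_ (by positivity)
  rw [bprob_compl] at hε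
  linarith

/-! ### From a full box to the whole square. -/

/-- All segments of length `M` that are needed to fill `[0,L]²` from a full box contain runs. -/
def linesEvent (a b L M : ℕ) : Set (Finset (ℤ × ℤ)) :=
  {S | (∀ j ∈ Finset.range M, ∀ y ∈ Finset.range (L + 1), S ∈ hrun a M ((j * M : ℕ) : ℤ) y) ∧
    ∀ x ∈ Finset.range (L + 1), S ∈ vrun b M x 0}

/-- The box first rises to a strip of full height, and the strip then spreads right and left; runs
among the lowest `M` sites of the columns suffice. -/
theorem square_subset_of_lines {L M w H : ℕ} (hM : M * M ≤ L + 1) (haw : a ≤ w) (hwH : w ≤ H)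
    (hbH : b ≤ H) (hHM : H ≤ M) {S : Finset (ℤ × ℤ)} (hlines : S ∈ linesEvent a b L M) {j : ℕ}
    (hj : j < M) (hseed : rect w b ((j * M : ℕ) : ℤ) ⊆ S)
    (hgrow : S ∈ growthEvent a b w H M ((j * M : ℕ) : ℤ)) :
    square L ⊆ finalConfig a b (square L) S := by
  have hF : Stable a b (square L) (finalConfig a b (square L) S) := finalConfig_stable _ _
  have hS : (S : Set (ℤ × ℤ)) ⊆ finalConfig a b (square L) S := subset_finalConfig _ _
  set F := finalConfig a b (square L) S
  have hjM : (j + 1) * M ≤ L + 1 := (Nat.mul_le_mul_right M hj).trans hM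
  set x₀ : ℤ := ((j * M : ℕ) : ℤ) with hx₀
  have hx₀0 : 0 ≤ x₀ := by positivity
  have hx₀L : x₀ + M ≤ L + 1 := by
    rw [hx₀]
    have : ((j + 1) * M : ℕ) ≤ ((L + 1 : ℕ) : ℤ) := by exact_mod_cast hjM
    push_cast at this ⊢
    linarith
  have hD : ∀ x y : ℤ, 0 ≤ x → x < L + 1 → 0 ≤ y → y < L + 1 → (x, y) ∈ square L :=
    fun x y h1 h2 h3 h4 => mem_square.2 (by simp only []; omega)
  have hbox := hF.rect_subset hS haw hwH hbH hHM (fun v hv => by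
    rw [mem_rect] at hv
    exact hD v.1 v.2 (by omega) (by omega) (by omega) (by omega)) hseed hgrow
  have strip : ∀ n : ℕ, n ≤ L + 1 → ∀ x y : ℤ, x₀ ≤ x → x < x₀ + M → 0 ≤ y → y < n →
      (x, y) ∈ F := by
    intro n
    induction n with
    | zero => intro _ x y _ _ _ _; omega
    | succ n ih =>
      intro hn x y h1 h2 h3 h4
      by_cases hyM : y < M
      · exact hbox _ (mem_rect.2 ⟨⟨h1, h2⟩, h3, hyM⟩)
      · by_cases hy : y < n
        · exact ih (by omega) x y h1 h2 h3 hy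
        · obtain rfl : y = n := by omega
          exact hF.fill_row_of_hrun hS (fun x h1 h2 => hD _ _ (by omega) (by omega) h3 (by omega))
            (fun x h1 h2 i hi hi' => ih (by omega) _ _ h1 h2 (by omega) (by omega))
            (by omega) (hlines.1 j (Finset.mem_range.2 hj) n (Finset.mem_range.2 (by omega))) x h1 h2
  have strip' := strip (L + 1) le_rfl
  have hvrun : ∀ x : ℤ, 0 ≤ x → x < L + 1 → S ∈ vrun b M x 0 := fun x h1 h2 => by
    have := hlines.2 x.toNat (Finset.mem_range.2 (by omega))
    rwa [Int.toNat_of_nonneg h1] at this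
  have hML : M ≤ L + 1 := (Nat.le_mul_self M).trans hM
  have right : ∀ n : ℕ, ∀ x y : ℤ, x₀ ≤ x → x < x₀ + n → x < L + 1 → 0 ≤ y → y < L + 1 →
      (x, y) ∈ F := by
    intro n
    induction n with
    | zero => intro x y _ _ _ _; omega
    | succ n ih =>
      intro x y h1 h2 h3 h4 h5
      by_cases hx : x < x₀ + M
      · exact strip' x y h1 hx h4 (by push_cast; omega)
      · exact hF.fill_column_of_vrun hS (Or.inr rfl)
          (fun y h1 h2 => hD _ _ (by omega) (by omega) h1 h2)
          (fun y h1 h2 i hi hi' => ih _ _ (by omega) (by omega) (by omega) h1 h2)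
          (by omega) (hvrun x (by omega) h3) y h4 h5
  have left : ∀ n : ℕ, ∀ x y : ℤ, x₀ - n ≤ x → 0 ≤ x → x < L + 1 → 0 ≤ y → y < L + 1 →
      (x, y) ∈ F := by
    intro n
    induction n with
    | zero =>
      intro x y h1 h2 h3 h4 h5
      exact right (L + 1) x y (by omega) (by push_cast; omega) h3 h4 h5
    | succ n ih =>
      intro x y h1 h2 h3 h4 h5
      by_cases hx : x₀ - n ≤ x
      · exact ih x y hx h2 h3 h4 h5
      · exact hF.fill_column_of_vrun hS (Or.inl rfl) (fun y h1 h2 => hD _ _ (by omega) h3 h1 h2)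
          (fun y h1 h2 i hi hi' => ih _ _ (by omega) (by omega) (by omega) h1 h2)
          (by omega) (hvrun x h2 h3) y h4 h5
  rintro ⟨x, y⟩ hv
  rw [mem_square] at hv
  exact left x₀.toNat x y (by omega) hv.1.1 (by omega) hv.2.1 (by omega)

theorem bprob_compl_linesEvent_le {p : ℝ} (hp0 : 0 ≤ p) (hp1 : p ≤ 1) {L M : ℕ}
    (hM : M * M ≤ L + 1) :
    bprob p (sites L) (linesEvent a b L M)ᶜ ≤
      M * (L + 1) * (1 - p ^ a) ^ (M / a) + (L + 1) * (1 - p ^ b) ^ (M / b) := by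
  refine (bprob_le_add hp0 hp1
    (E₁ := {S | ∀ z ∈ Finset.range M ×ˢ Finset.range (L + 1),
      S ∈ hrun a M ((z.1 * M : ℕ) : ℤ) (z.2 : ℕ)}ᶜ)
    (E₂ := {S | ∀ x ∈ Finset.range (L + 1), S ∈ vrun b M (x : ℕ) 0}ᶜ) ?_).trans
    (add_le_add ?_ ?_)
  · intro S _ hS
    rw [← Set.mem_union, ← Set.compl_inter]
    intro hcon
    refine hS ⟨fun j hj y hy => hcon.1 (j, y) (Finset.mem_product.2 ⟨hj, hy⟩), hcon.2⟩
  · refine (bprob_not_forall_le hp0 hp1 _ _).trans ?_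
    refine (Finset.sum_le_card_nsmul _ _ ((1 - p ^ a) ^ (M / a)) fun z hz => ?_).trans ?_
    · rw [Finset.mem_product, Finset.mem_range, Finset.mem_range] at hz
      refine (bprob_compl_hrun fun v hv => ?_).le
      have h1 : (z.1 + 1) * M ≤ L + 1 := (Nat.mul_le_mul_right M hz.1).trans hM
      have h2 : z.1 * M + M ≤ L + 1 := by linarith
      rw [mem_hblock] at hv
      rw [mem_sites]
      omega
    · rw [nsmul_eq_mul, Finset.card_product, Finset.card_range, Finset.card_range]
      push_cast
      exact le_rfl
  · refine (bprob_not_forall_le hp0 hp1 _ _).trans ?_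
    refine (Finset.sum_le_card_nsmul _ _ ((1 - p ^ b) ^ (M / b)) fun x hx => ?_).trans ?_
    · rw [Finset.mem_range] at hx
      refine (bprob_compl_vrun fun v hv => ?_).le
      have h1 : M ≤ L + 1 := (Nat.le_mul_self M).trans hM
      rw [mem_vblock] at hv
      rw [mem_sites]
      omega
    · rw [nsmul_eq_mul, Finset.card_range]
      push_cast
      exact le_rfl

/-- The `M` boxes are disjoint, hence succeed independently. The event on lines depends on the same
sites, but enters only through a union bound. -/
theorem le_bprob_spanned {p : ℝ} (hp0 : 0 ≤ p) (hp1 : p ≤ 1)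
    {L M w H : ℕ} (hM : M * M ≤ L + 1) (haw : a ≤ w) (hwH : w ≤ H) (hbH : b ≤ H) (hHM : H ≤ M)
    {ε : ℝ} (hε : H * (1 - p ^ a) ^ (w / a) + H * (1 - p ^ b) ^ (H / b) +
      (∑ n ∈ Finset.Ico H M, (1 - p ^ b) ^ (n / b) +
        ∑ n ∈ Finset.Ico H M, (1 - p ^ a) ^ (n / a)) ≤ ε) :
    1 - (1 - p ^ (w * b) * (1 - ε)) ^ M -
      (M * (L + 1) * (1 - p ^ a) ^ (M / a) + (L + 1) * (1 - p ^ b) ^ (M / b)) ≤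
    bprob p (sites L) {S | square L ⊆ finalConfig a b (square L) S} := by
  let G : ℕ → Finset (ℤ × ℤ) := fun j => rect M M ((j * M : ℕ) : ℤ)
  let E : ℕ → Set (Finset (ℤ × ℤ)) := fun j =>
    {S | rect w b ((j * M : ℕ) : ℤ) ⊆ S} ∩ growthEvent a b w H M ((j * M : ℕ) : ℤ)
  have hmain := bprob_le_add hp0 hp1 (F := sites L)
    (E := {S | square L ⊆ finalConfig a b (square L) S}ᶜ)
    (E₁ := {S | ∀ j ∈ Finset.range M, S ∩ G j ∈ (E j)ᶜ}) (E₂ := (linesEvent a b L M)ᶜ)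
    fun S _ hS => by
      by_contra! hcon
      obtain ⟨h1, h2⟩ := hcon
      simp only [Set.mem_ofPred_eq, not_forall, Set.mem_compl_iff, not_not] at h1 h2
      obtain ⟨j, hj, hE⟩ := h1
      exact hS (square_subset_of_lines hM haw hwH hbH hHM h2 (Finset.mem_range.1 hj)
        (hE.1.trans Finset.inter_subset_left)
        (isUpperSet_growthEvent _ _ _ _ _ _ Finset.inter_subset_left hE.2))
  have hboxes : bprob p (sites L) {S | ∀ j ∈ Finset.range M, S ∩ G j ∈ (E j)ᶜ} ≤
      (1 - p ^ (w * b) * (1 - ε)) ^ M := by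
    rw [bprob_forall_of_pairwiseDisjoint p (Finset.range M) G ?_ ?_ (fun j => (E j)ᶜ)]
    · nth_rewrite 2 [← Finset.card_range M]
      rw [← Finset.prod_const]
      refine Finset.prod_le_prod (fun j _ => bprob_nonneg hp0 hp1 _ _) fun j _ => ?_
      rw [bprob_compl]
      have := le_bprob_seed (a := a) hp0 hp1 (hwH.trans hHM) (hbH.trans hHM) ((j * M : ℕ) : ℤ)
        ((bprob_compl_growthEvent_le hp0 hp1 hwH hHM _).trans hε)
      exact sub_le_sub_left this 1
    · intro j hj v hv
      rw [Finset.mem_range] at hj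
      have h1 : (j + 1) * M ≤ L + 1 := (Nat.mul_le_mul_right M hj).trans hM
      have h2 : j * M + M ≤ L + 1 := by linarith
      have h3 : M ≤ L + 1 := (Nat.le_mul_self M).trans hM
      rw [mem_rect] at hv
      rw [mem_sites]
      omega
    · intro i _ j _ hij
      refine Finset.disjoint_left.2 fun v hv hv' => hij ?_
      simp only [G, mem_rect, Nat.cast_mul] at hv hv'
      exact le_antisymm (add_mul_le_of_lt (c := 0) (x := v.1) (m := M) (by linarith [hv'.1.2]) (by linarith [hv.1.1]))
        (add_mul_le_of_lt (c := 0) (x := v.1) (m := M) (by linarith [hv.1.2]) (by linarith [hv'.1.1]))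
  rw [bprob_compl] at hmain
  have hl := bprob_compl_linesEvent_le (a := a) (b := b) hp0 hp1 hM
  linarith

end Growth

/-! ### Asymptotics below the threshold, in the variable t = -log p. -/

section Asymptotics

variable {a b : ℕ}

theorem div_sub_one_le_natDiv {n r : ℕ} (hr : 1 ≤ r) : (n : ℝ) / r - 1 ≤ (n / r : ℕ) := by
  have h1 : n < r * (n / r + 1) := Nat.lt_mul_div_succ n (by omega)
  have h2 : (n : ℝ) ≤ r * ((n / r : ℕ) + 1) := by exact_mod_cast h1.le
  have hr' : (0 : ℝ) < r := by exact_mod_cast hr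
  rw [sub_le_iff_le_add, div_le_iff₀ hr']
  linarith

theorem one_sub_pow_le_exp {x : ℝ} (hx1 : x ≤ 1) (n : ℕ) :
    (1 - x) ^ n ≤ Real.exp (-(x * n)) := by
  have h := pow_le_pow_left₀ (by linarith : 0 ≤ 1 - x) (Real.one_sub_le_exp_neg x) n
  rw [← Real.exp_nat_mul] at h
  rwa [show -(x * n) = n * -x by ring]

theorem one_sub_pow_div_le {x : ℝ} (hx0 : 0 ≤ x) (hx1 : x ≤ 1) {n r : ℕ} (hr : 1 ≤ r) :
    (1 - x) ^ (n / r) ≤ Real.exp 1 * Real.exp (-(x * (n / r : ℝ))) := by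
  refine (one_sub_pow_le_exp hx1 _).trans ?_
  rw [← Real.exp_add]
  refine Real.exp_le_exp.2 ?_
  have := mul_le_mul_of_nonneg_left (div_sub_one_le_natDiv (n := n) hr) hx0
  linarith

theorem exp_neg_two_mul_le {x : ℝ} (hx0 : 0 ≤ x) (hx : x ≤ 1 / 2) :
    Real.exp (-(2 * x)) ≤ 1 - x := by
  rw [Real.exp_neg, inv_le_comm₀ (Real.exp_pos _) (by linarith)]
  have h := Real.add_one_le_exp (2 * x)
  refine le_trans ?_ h
  rw [inv_le_iff_one_le_mul₀ (by linarith)]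
  nlinarith

theorem exp_neg_pow (t : ℝ) (n : ℕ) : Real.exp (-t) ^ n = Real.exp (-(n * t)) := by
  rw [← Real.exp_nat_mul]
  ring_nf

theorem eventually_le_exp_div (K : ℝ) {d : ℝ} (hd : 0 < d) : ∀ᶠ t : ℝ in atTop,
    K ≤ Real.exp (t / d) :=
  (Real.tendsto_exp_atTop.comp (tendsto_id.atTop_div_const hd)).eventually_ge_atTop K

theorem eventually_mul_sq_le_exp (K : ℝ) : ∀ᶠ t : ℝ in atTop, K * t ^ 2 ≤ Real.exp (t / 4) := by
  -- The cubic term of the exponential series is (t/4)³/3! = t³/384.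
  filter_upwards [eventually_ge_atTop (384 * K), eventually_ge_atTop 0] with t ht h0
  have h := Real.pow_div_factorial_le_exp (t / 4) (by positivity) 3
  refine le_trans ?_ h
  have : ((Nat.factorial 3 : ℕ) : ℝ) = 6 := by norm_num [Nat.factorial]
  rw [this]
  nlinarith [mul_le_mul_of_nonneg_right ht (sq_nonneg t)]

/-- The scale of the width of a critical droplet. -/
noncomputable def widthConst (b : ℕ) : ℝ := 1 / (32 * ballSubsets (b ^ 2) * stripWidth b)

theorem one_le_ballSubsets (M : ℕ) : (1 : ℝ) ≤ ballSubsets M := by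
  exact_mod_cast Nat.one_le_two_pow

theorem one_le_stripWidth (b : ℕ) : (1 : ℝ) ≤ stripWidth b := by
  simp only [stripWidth]
  exact_mod_cast Nat.le_add_left 1 _

theorem widthConst_pos (b : ℕ) : 0 < widthConst b := by
  have h1 := one_le_ballSubsets (b ^ 2)
  have h2 := one_le_stripWidth b
  unfold widthConst
  positivity

/-- The height p^(-a-1/2) against p^b with b ≥ a+1 leaves p^(1/2), and half of this power pays for
the constants. The summand t/4 comes from rounding the number of strips. -/
theorem eventually_vertical_bound (ha : 1 ≤ a) (hab : a < b) : ∀ᶠ t : ℝ in atTop,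
    ((stripWidth b * (2 * ⌈Real.exp ((a + 1 / 2) * t)⌉₊ + 2 * b) : ℕ) *
      (ballSubsets (b ^ 2) * Real.exp (-t) ^ b)) ^
        (⌈widthConst b * Real.exp (a * t) * t⌉₊ / stripWidth b) ≤
      Real.exp (-(widthConst b / (4 * stripWidth b) * (Real.exp (a * t) * t ^ 2)) + t / 4) := by
  have hC := one_le_ballSubsets (b ^ 2)
  have hm := one_le_stripWidth b
  have hc := widthConst_pos b
  set C : ℝ := (ballSubsets (b ^ 2) : ℝ)
  set c := widthConst b
  have hm1 : 1 ≤ stripWidth b := by exact_mod_cast hm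
  set m : ℝ := (stripWidth b : ℝ) with hm_def
  filter_upwards [eventually_ge_atTop 0,
    eventually_le_exp_div (m * (4 + 2 * b) * C) (by norm_num : (0 : ℝ) < 4)] with t ht h1
  have hceil : (⌈Real.exp ((a + 1 / 2) * t)⌉₊ : ℝ) ≤ Real.exp ((a + 1 / 2) * t) + 1 :=
    (Nat.ceil_lt_add_one (Real.exp_pos _).le).le
  have hone : 1 ≤ Real.exp ((a + 1 / 2) * t) := Real.one_le_exp (by positivity)
  have hb' : (a : ℝ) + 1 ≤ b := by exact_mod_cast hab
  have hbase : ((stripWidth b * (2 * ⌈Real.exp ((a + 1 / 2) * t)⌉₊ + 2 * b) : ℕ) : ℝ) *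
      (C * Real.exp (-t) ^ b) ≤ Real.exp (-(t / 4)) := by
    push_cast
    rw [← hm_def, exp_neg_pow]
    calc m * (2 * (⌈Real.exp ((a + 1 / 2) * t)⌉₊ : ℝ) + 2 * b) * (C * Real.exp (-(b * t)))
        ≤ m * ((4 + 2 * b) * Real.exp ((a + 1 / 2) * t)) * (C * Real.exp (-(b * t))) := by
          refine mul_le_mul_of_nonneg_right (mul_le_mul_of_nonneg_left ?_ (by linarith))
            (by positivity)
          nlinarith [(Nat.cast_nonneg b : (0 : ℝ) ≤ b)]
      _ = m * (4 + 2 * b) * C * (Real.exp ((a + 1 / 2) * t) * Real.exp (-(b * t))) := by ring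
      _ ≤ Real.exp (t / 4) * Real.exp (-(t / 2)) := by
          refine mul_le_mul h1 ?_ (by positivity) (Real.exp_pos _).le
          rw [← Real.exp_add]
          refine Real.exp_le_exp.2 ?_
          nlinarith
      _ = Real.exp (-(t / 4)) := by rw [← Real.exp_add]; ring_nf
  refine (pow_le_pow_left₀ (by positivity) hbase _).trans ?_
  rw [← Real.exp_nat_mul]
  refine Real.exp_le_exp.2 ?_
  have hN := div_sub_one_le_natDiv (n := ⌈c * Real.exp (a * t) * t⌉₊) hm1
  have hk := Nat.le_ceil (c * Real.exp (a * t) * t)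
  have hk' : c * Real.exp (a * t) * t / m ≤ (⌈c * Real.exp (a * t) * t⌉₊ : ℝ) / m := by gcongr
  have h3 := mul_le_mul_of_nonneg_right ((sub_le_sub_right hk' 1).trans hN)
    (by positivity : 0 ≤ t / 4)
  have h4 : (c * Real.exp (a * t) * t / m - 1) * (t / 4) =
      c / (4 * m) * (Real.exp (a * t) * t ^ 2) - t / 4 := by
    field_simp
  linarith

/-- The constant c is so small that a horizontal strip stays without a cluster with probability at
least exp(-t/4). Then p^(-a-1/2)/m strips give exp(-Z exp(t/4)/m), up to rounding, which beats the
required exponent by an exponential factor. -/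
theorem eventually_horizontal_bound (ha : 1 ≤ a) : ∀ᶠ t : ℝ in atTop,
    (1 - (1 - ballSubsets (b ^ 2) * Real.exp (-t) ^ a) ^ (stripWidth b *
        (2 * ⌈widthConst b * Real.exp (a * t) * t⌉₊ + 2 * b))) ^
          (⌈Real.exp ((a + 1 / 2) * t)⌉₊ / stripWidth b) ≤
      Real.exp (-(widthConst b / (4 * stripWidth b) * (Real.exp (a * t) * t ^ 2)) + 1) := by
  have hC := one_le_ballSubsets (b ^ 2)
  have hm := one_le_stripWidth b
  have hc := widthConst_pos b
  have hc_def : widthConst b = 1 / (32 * ballSubsets (b ^ 2) * stripWidth b) := rfl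
  set C : ℝ := (ballSubsets (b ^ 2) : ℝ)
  set c := widthConst b
  have hm1 : 1 ≤ stripWidth b := by exact_mod_cast hm
  set m : ℝ := (stripWidth b : ℝ) with hm_def
  have ha' : (1 : ℝ) ≤ a := by exact_mod_cast ha
  filter_upwards [eventually_ge_atTop 0, eventually_mul_sq_le_exp (c / 4),
    eventually_le_exp_div (2 * C) (by norm_num : (0 : ℝ) < 1),
    eventually_ge_atTop (16 * C * m * (2 + 2 * b))] with t ht h1 h2 h3
  have hZ : Real.exp (-t) ^ a * Real.exp (a * t) = 1 := by
    rw [exp_neg_pow, ← Real.exp_add]; simp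
  have hZ0 := Real.exp_pos (a * t)
  have hpa1 : Real.exp (-t) ^ a ≤ Real.exp (-t) := by
    rw [exp_neg_pow]
    exact Real.exp_le_exp.2 (by nlinarith)
  have hp1 : Real.exp (-t) ≤ 1 := Real.exp_le_one_iff.2 (by linarith)
  set x := C * Real.exp (-t) ^ a with hx
  have hx0 : 0 ≤ x := by positivity
  have hx1 : x ≤ 1 / 2 := by
    have h4 : Real.exp (t / 1) * Real.exp (-t) = 1 := by rw [← Real.exp_add]; simp
    have h5 := mul_le_mul_of_nonneg_right h2 (Real.exp_pos (-t)).le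
    have h6 := mul_le_mul_of_nonneg_left hpa1 (by linarith : 0 ≤ C)
    linarith
  set k := ⌈c * Real.exp (a * t) * t⌉₊ with hk
  have hk1 : (k : ℝ) ≤ c * Real.exp (a * t) * t + 1 := (Nat.ceil_lt_add_one (by positivity)).le
  have hgood : Real.exp (-(t / 4)) ≤ (1 - x) ^ (stripWidth b * (2 * k + 2 * b)) := by
    refine le_trans ?_ (pow_le_pow_left₀ (Real.exp_pos _).le (exp_neg_two_mul_le hx0 hx1) _)
    rw [← Real.exp_nat_mul]
    refine Real.exp_le_exp.2 ?_
    push_cast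
    rw [← hm_def]
    have h4 : m * (2 * k + 2 * b) * (2 * x) ≤
        m * (2 * (c * Real.exp (a * t) * t + 1) + 2 * b) * (2 * x) := by gcongr
    have h5 : m * (2 * (c * Real.exp (a * t) * t + 1) + 2 * b) * (2 * x) =
        4 * m * C * c * t * (Real.exp (-t) ^ a * Real.exp (a * t)) +
          2 * C * m * (2 + 2 * b) * Real.exp (-t) ^ a := by rw [hx]; ring
    -- This fixes the 32 in `widthConst`: the main term contributes t/8, and the lower-order one at
    -- most another t/8 by the last lower bound on `t`.
    have h6 : 4 * m * C * c = 1 / 8 := by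
      rw [hc_def]; field_simp; norm_num
    have h7 : 2 * C * m * (2 + 2 * b) * Real.exp (-t) ^ a ≤ 2 * C * m * (2 + 2 * b) * 1 := by
      have := hpa1.trans hp1
      gcongr
    rw [hZ, h6] at h5
    linarith
  set N := ⌈Real.exp ((a + 1 / 2) * t)⌉₊ / stripWidth b with hN
  have hbase0 : 0 ≤ 1 - (1 - x) ^ (stripWidth b * (2 * k + 2 * b)) :=
    sub_nonneg.2 (pow_le_one₀ (by linarith) (by linarith))
  refine (pow_le_pow_left₀ hbase0 (sub_le_sub_left hgood 1) N).trans ?_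
  refine (one_sub_pow_le_exp (Real.exp_le_one_iff.2 (by linarith)) N).trans ?_
  refine Real.exp_le_exp.2 ?_
  have hN1 := div_sub_one_le_natDiv (n := ⌈Real.exp ((a + 1 / 2) * t)⌉₊) hm1
  have hceil := Nat.le_ceil (Real.exp ((a + 1 / 2) * t))
  have hN2 : Real.exp ((a + 1 / 2) * t) / m - 1 ≤ N := by
    refine le_trans (sub_le_sub_right ?_ 1) hN1
    gcongr
  have h8 := mul_le_mul_of_nonneg_left hN2 (Real.exp_pos (-(t / 4))).le
  have h9 : Real.exp (-(t / 4)) * (Real.exp ((a + 1 / 2) * t) / m - 1) =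
      Real.exp (a * t) * Real.exp (t / 4) / m - Real.exp (-(t / 4)) := by
    rw [mul_sub, mul_one, mul_div_assoc', ← Real.exp_add, ← Real.exp_add]
    ring_nf
  have h10 : Real.exp (-(t / 4)) ≤ 1 := Real.exp_le_one_iff.2 (by linarith)
  have h11 : c / (4 * m) * (Real.exp (a * t) * t ^ 2) ≤
      Real.exp (a * t) * Real.exp (t / 4) / m := by
    have : c / (4 * m) * (Real.exp (a * t) * t ^ 2) = Real.exp (a * t) * (c / 4 * t ^ 2) / m := by
      field_simp
    rw [this]
    gcongr
  linarith

theorem tendsto_exp_neg_mul_sq_add (K : ℝ) {d : ℝ} (hd : 0 < d) (e f : ℝ) :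
    Tendsto (fun t : ℝ => K * Real.exp (-(d * t ^ 2) + e * t + f)) atTop (𝓝 0) := by
  rw [← mul_zero K]
  refine Tendsto.const_mul K (Real.tendsto_exp_atBot.comp ?_)
  refine tendsto_atBot_mono' atTop (f₁ := fun t => -t + f) ?_
    (tendsto_atBot_add_const_right _ _ tendsto_neg_atTop_atBot)
  filter_upwards [eventually_ge_atTop ((e + 1) / d), eventually_ge_atTop 0] with t ht h0
  rw [div_le_iff₀ hd] at ht
  nlinarith

/-- Below the critical scale, the probability of internal spanning is small. -/
theorem exists_subcritical_bound (ha : 1 ≤ a) (hab : a < b) : ∃ γ > (0 : ℝ), ∃ B : ℝ → ℝ,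
    Tendsto B atTop (𝓝 0) ∧ ∀ᶠ t : ℝ in atTop, ∀ L : ℕ,
      (L : ℝ) < Real.exp (γ * Real.exp (a * t) * t ^ 2) →
      bprob (Real.exp (-t)) (sites L) {S | square L ⊆ finalConfig a b (square L) S} ≤ B t := by
  have hC := one_le_ballSubsets (b ^ 2)
  have hm := one_le_stripWidth b
  have hc := widthConst_pos b
  have hv := eventually_vertical_bound ha hab
  have hh := eventually_horizontal_bound (b := b) ha
  have hm1 : 1 ≤ stripWidth b := by exact_mod_cast hm
  obtain ⟨C, hC_def⟩ : ∃ C : ℝ, C = ballSubsets (b ^ 2) := ⟨_, rfl⟩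
  obtain ⟨c, hc_def⟩ : ∃ c : ℝ, c = widthConst b := ⟨_, rfl⟩
  obtain ⟨m, hm_def⟩ : ∃ m : ℝ, m = stripWidth b := ⟨_, rfl⟩
  rw [← hC_def] at hC
  rw [← hm_def] at hm
  rw [← hc_def] at hc
  have ha' : (1 : ℝ) ≤ a := by exact_mod_cast ha
  have hb' : (a : ℝ) + 1 ≤ b := by exact_mod_cast hab
  have hd : 0 < c / (8 * m) := by positivity
  -- The factor (L+1)^4 costs 4c/(32m) = c/(8m) in the exponent, half of the available c/(4m). The
  -- last summands of the bound treat squares with `L < k`.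
  refine ⟨c / (32 * m), by positivity, fun t =>
    (16 * Real.exp (-(c / (8 * m) * t ^ 2) + 1 / 4 * t + 0) +
      16 * Real.exp (-(c / (8 * m) * t ^ 2) + 0 * t + 1)) +
    (m * C * c * (t ^ 1 * Real.exp (-t)) + (m * C + m ^ 2) * (t ^ 0 * Real.exp (-t))), ?_, ?_⟩
  · have h1 := tendsto_exp_neg_mul_sq_add 16 hd (1 / 4) 0
    have h2 := tendsto_exp_neg_mul_sq_add 16 hd 0 1
    have h3 := (Real.tendsto_pow_mul_exp_neg_atTop_nhds_zero 1).const_mul (m * C * c)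
    have h4 := (Real.tendsto_pow_mul_exp_neg_atTop_nhds_zero 0).const_mul (m * C + m ^ 2)
    simpa using (h1.add h2).add (h3.add h4)
  · filter_upwards [hv, hh, eventually_gt_atTop 0,
      eventually_le_exp_div C (by norm_num : (0 : ℝ) < 1)] with t hvt hht ht htC L hL
    have hp0 : 0 ≤ Real.exp (-t) := (Real.exp_pos _).le
    have hp1 : Real.exp (-t) ≤ 1 := Real.exp_le_one_iff.2 (by linarith)
    have hZ1 : 1 ≤ Real.exp (a * t) := Real.one_le_exp (by positivity)
    rw [← hc_def, ← hm_def] at hvt hht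
    set k := ⌈c * Real.exp (a * t) * t⌉₊ with hk
    set h := ⌈Real.exp ((a + 1 / 2) * t)⌉₊ with hh_def
    set Z := Real.exp (a * t) with hZ
    by_cases hkL : k ≤ L
    · have hk1 : 1 ≤ k := Nat.one_le_ceil_iff.2 (by positivity)
      have hh1 : 1 ≤ h := Nat.one_le_ceil_iff.2 (Real.exp_pos _)
      have hCp : ballSubsets (b ^ 2) * Real.exp (-t) ^ a ≤ 1 := by
        rw [← hC_def]
        have h4 : Real.exp (t / 1) * Real.exp (-t) = 1 := by rw [← Real.exp_add]; simp
        have h5 := mul_le_mul_of_nonneg_right htC hp0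
        have h6 : Real.exp (-t) ^ a ≤ Real.exp (-t) ^ 1 := pow_le_pow_of_le_one hp0 hp1 ha
        rw [pow_one] at h6
        have h7 := mul_le_mul_of_nonneg_left h6 (by linarith : 0 ≤ C)
        linarith
      refine (bprob_spanned_le ha hab hp0 hp1 hk1 hh1 hkL hCp).trans ?_
      have hL4 : ((L : ℝ) + 1) ^ 4 ≤ 16 * Real.exp (4 * (c / (32 * m) * Z * t ^ 2)) := by
        have h1 : 1 ≤ Real.exp (c / (32 * m) * Z * t ^ 2) := Real.one_le_exp (by positivity)
        have h2 : (L : ℝ) + 1 ≤ 2 * Real.exp (c / (32 * m) * Z * t ^ 2) := by linarith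
        have h3 := pow_le_pow_left₀ (by positivity) h2 4
        rw [mul_pow, ← Real.exp_nat_mul] at h3
        norm_num at h3
        exact h3
      refine (mul_le_mul hL4 (add_le_add hvt hht) ?_ (by positivity)).trans ?_
      · refine add_nonneg (by positivity) (pow_nonneg (sub_nonneg.2 (pow_le_one₀ ?_ ?_)) _)
        · linarith
        · have : 0 ≤ ballSubsets (b ^ 2) * Real.exp (-t) ^ a := by positivity
          linarith
      · have hle : c / (8 * m) * t ^ 2 ≤ c / (8 * m) * (Z * t ^ 2) := by
          have : t ^ 2 ≤ Z * t ^ 2 := by nlinarith [sq_nonneg t]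
          gcongr
        have hsub : ∀ s : ℝ, 4 * (c / (32 * m) * Z * t ^ 2) +
            (-(c / (4 * m) * (Z * t ^ 2)) + s) = -(c / (8 * m) * (Z * t ^ 2)) + s := by
          intro s
          field_simp
          ring
        rw [mul_assoc, mul_add, ← Real.exp_add, ← Real.exp_add, hsub, hsub]
        have e1 : Real.exp (-(c / (8 * m) * (Z * t ^ 2)) + t / 4) ≤
            Real.exp (-(c / (8 * m) * t ^ 2) + 1 / 4 * t + 0) := Real.exp_le_exp.2 (by linarith)
        have e2 : Real.exp (-(c / (8 * m) * (Z * t ^ 2)) + 1) ≤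
            Real.exp (-(c / (8 * m) * t ^ 2) + 0 * t + 1) := Real.exp_le_exp.2 (by linarith)
        have e3 : 0 ≤ m * C * c * (t ^ 1 * Real.exp (-t)) +
          (m * C + m ^ 2) * (t ^ 0 * Real.exp (-t)) := by positivity
        linarith
    · refine (bprob_spanned_le_of_small ha hab hp0 hp1 L).trans ?_
      rw [← hC_def, ← hm_def, exp_neg_pow]
      have hLk : (L : ℝ) + 1 ≤ c * Z * t + 1 := by
        have h1 : (L : ℝ) + 1 ≤ k := by exact_mod_cast not_le.1 hkL
        exact h1.trans (Nat.ceil_lt_add_one (by positivity)).le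
      have h1 : m * ((L : ℝ) + 1) * (C * Real.exp (-(b * t))) ≤
          m * (c * Z * t + 1) * (C * Real.exp (-(b * t))) := by gcongr
      have h2 : m * (c * Z * t + 1) * (C * Real.exp (-(b * t))) =
          m * C * c * t * (Z * Real.exp (-(b * t))) + m * C * Real.exp (-(b * t)) := by ring
      have h3 : Z * Real.exp (-(b * t)) ≤ Real.exp (-t) := by
        rw [hZ, ← Real.exp_add]
        exact Real.exp_le_exp.2 (by nlinarith)
      have h4 : Real.exp (-(b * t)) ≤ Real.exp (-t) := Real.exp_le_exp.2 (by nlinarith)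
      have h5 : m * C * c * t * (Z * Real.exp (-(b * t))) ≤ m * C * c * t * Real.exp (-t) := by
        gcongr
      have h6 : m * C * Real.exp (-(b * t)) ≤ m * C * Real.exp (-t) := by gcongr
      have e1 := Real.exp_pos (-(c / (8 * m) * t ^ 2) + 1 / 4 * t + 0)
      have e2 := Real.exp_pos (-(c / (8 * m) * t ^ 2) + 0 * t + 1)
      rw [pow_one, pow_zero]
      linarith

/-! ### Asymptotics above the threshold. -/

theorem sum_Ico_exp_neg_le {s : ℝ} (hs0 : 0 < s) (hs1 : s ≤ 1) (H M : ℕ) :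
    ∑ n ∈ Finset.Ico H M, Real.exp (-(s * n)) ≤ 2 / s * Real.exp (-(s * H)) := by
  have hρ : Real.exp (-s) ≤ 1 - s / 2 := by
    have := exp_neg_two_mul_le (x := s / 2) (by linarith) (by linarith)
    rwa [show 2 * (s / 2) = s by ring] at this
  -- Each term is dominated by a telescoping difference, so the bound is uniform in `M`.
  have key : ∀ n : ℕ, Real.exp (-(s * n)) ≤
      2 / s * Real.exp (-(s * n)) - 2 / s * Real.exp (-(s * (n + 1 : ℕ))) := by
    intro n
    have e : Real.exp (-(s * (n + 1 : ℕ))) = Real.exp (-(s * n)) * Real.exp (-s) := by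
      rw [← Real.exp_add]; push_cast; ring_nf
    have h1 := mul_le_mul_of_nonneg_left hρ (Real.exp_pos (-(s * n))).le
    rw [e]
    have h2 := mul_le_mul_of_nonneg_left h1 (by positivity : 0 ≤ 2 / s)
    have h3 : 2 / s * (Real.exp (-(s * n)) * (1 - s / 2)) =
        2 / s * Real.exp (-(s * n)) - Real.exp (-(s * n)) := by field_simp
    linarith
  rcases le_total H M with h | h
  · refine (Finset.sum_le_sum fun n _ => key n).trans ?_
    have hpos : 0 ≤ 2 / s * Real.exp (-(s * M)) := by positivity
    have htel := Finset.sum_Ico_sub (fun n : ℕ => -(2 / s * Real.exp (-(s * n)))) h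
    have heq : ∑ n ∈ Finset.Ico H M, (2 / s * Real.exp (-(s * n)) -
        2 / s * Real.exp (-(s * (n + 1 : ℕ)))) = ∑ n ∈ Finset.Ico H M,
        (-(2 / s * Real.exp (-(s * (n + 1 : ℕ)))) - -(2 / s * Real.exp (-(s * n)))) :=
      Finset.sum_congr rfl fun n _ => by ring
    rw [heq, htel]
    linarith
  · rw [Finset.Ico_eq_empty_of_le h, Finset.sum_empty]
    positivity

theorem sum_Ico_one_sub_pow_div_le {x : ℝ} (hx0 : 0 < x) (hx1 : x ≤ 1) {r : ℕ} (hr : 1 ≤ r)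
    (H M : ℕ) : ∑ n ∈ Finset.Ico H M, (1 - x) ^ (n / r) ≤
      2 * Real.exp 1 * (r / x) * Real.exp (-(x * (H / r : ℝ))) := by
  have hr' : (1 : ℝ) ≤ r := by exact_mod_cast hr
  have hs1 : x / r ≤ 1 := (div_le_one (by linarith)).2 (by linarith)
  have h := sum_Ico_exp_neg_le (s := x / r) (by positivity) hs1 H M
  have h2 : ∑ n ∈ Finset.Ico H M, (1 - x) ^ (n / r) ≤
      Real.exp 1 * ∑ n ∈ Finset.Ico H M, Real.exp (-(x / r * n)) := by
    rw [Finset.mul_sum]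
    refine Finset.sum_le_sum fun n _ => ?_
    have := one_sub_pow_div_le hx0.le hx1 (n := n) hr
    rwa [show x * (n / r : ℝ) = x / r * n by ring] at this
  refine h2.trans ((mul_le_mul_of_nonneg_left h (Real.exp_pos 1).le).trans (le_of_eq ?_))
  rw [show x * (H / r : ℝ) = x / r * H by ring]
  field_simp

theorem tendsto_exp_mul_exp_neg_exp (c : ℝ) {d : ℝ} (hd : 0 < d) :
    Tendsto (fun t : ℝ => Real.exp (c * t) * Real.exp (-(Real.exp t / d))) atTop (𝓝 0) := by
  have h : ∀ t : ℝ, Real.exp (c * t) * Real.exp (-(Real.exp t / d)) =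
      Real.exp (c * t - Real.exp t / d) := fun t => by rw [← Real.exp_add]; ring_nf
  simp_rw [h]
  refine Real.tendsto_exp_atBot.comp (tendsto_atBot_mono' atTop (f₁ := fun t => -t) ?_
    tendsto_neg_atTop_atBot)
  filter_upwards [eventually_ge_atTop (2 * d * (c + 1)), eventually_ge_atTop 0] with t h1 h0
  have h2 := Real.pow_div_factorial_le_exp t h0 2
  have h3 : t ^ 2 / 2 ≤ Real.exp t := by simpa using h2
  have h4 : t ^ 2 / 2 / d ≤ Real.exp t / d := by gcongr
  have h5 : (c + 1) * t ≤ t ^ 2 / 2 / d := by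
    rw [le_div_iff₀ hd]
    nlinarith
  linarith

/-- The growth of a seed of width of order `p ^ (-a) * log (1 / p)` fails with small probability. -/
theorem eventually_growth_bound (ha : 1 ≤ a) (hab : a < b) : ∀ᶠ t : ℝ in atTop, ∀ M : ℕ,
    (⌈Real.exp ((b + 1) * t)⌉₊ : ℝ) *
        (1 - Real.exp (-t) ^ a) ^ (⌈(a * (b + 2) : ℝ) * Real.exp (a * t) * t⌉₊ / a) +
      (⌈Real.exp ((b + 1) * t)⌉₊ : ℝ) *
        (1 - Real.exp (-t) ^ b) ^ (⌈Real.exp ((b + 1) * t)⌉₊ / b) +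
      (∑ n ∈ Finset.Ico ⌈Real.exp ((b + 1) * t)⌉₊ M, (1 - Real.exp (-t) ^ b) ^ (n / b) +
        ∑ n ∈ Finset.Ico ⌈Real.exp ((b + 1) * t)⌉₊ M, (1 - Real.exp (-t) ^ a) ^ (n / a)) ≤
      1 / 2 := by
  have ha' : (1 : ℝ) ≤ a := by exact_mod_cast ha
  have hb' : (a : ℝ) + 1 ≤ b := by exact_mod_cast hab
  have hb0 : (0 : ℝ) < b := by linarith
  have hb1 : 1 ≤ b := by omega
  have hlim : Tendsto (fun t : ℝ => 2 * Real.exp 1 * Real.exp (-t) +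
      2 * Real.exp 1 * (Real.exp ((b + 1) * t) * Real.exp (-(Real.exp t / b))) +
      2 * (2 * Real.exp 1 * b * (Real.exp (b * t) * Real.exp (-(Real.exp t / b))))) atTop
      (𝓝 0) := by
    have h1 : Tendsto (fun t : ℝ => Real.exp (-t)) atTop (𝓝 0) :=
      Real.tendsto_exp_neg_atTop_nhds_zero
    have h2 := tendsto_exp_mul_exp_neg_exp (b + 1) hb0
    have h3 := tendsto_exp_mul_exp_neg_exp b hb0
    simpa using ((h1.const_mul (2 * Real.exp 1)).add (h2.const_mul (2 * Real.exp 1))).add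
      ((h3.const_mul (2 * Real.exp 1 * b)).const_mul 2)
  filter_upwards [hlim.eventually_le_const (by norm_num : (0 : ℝ) < 1 / 2),
    eventually_gt_atTop 0] with t ht h0 M
  refine le_trans ?_ ht
  set H := ⌈Real.exp ((b + 1) * t)⌉₊ with hH
  have hH1 : Real.exp ((b + 1) * t) ≤ H := Nat.le_ceil _
  have hone : 1 ≤ Real.exp ((b + 1) * t) := Real.one_le_exp (by positivity)
  have hH2 : (H : ℝ) ≤ 2 * Real.exp ((b + 1) * t) := by
    have := (Nat.ceil_lt_add_one (Real.exp_pos ((b + 1) * t)).le).le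
    linarith
  have hp : ∀ r : ℕ, Real.exp (-t) ^ r ≤ 1 := fun r =>
    pow_le_one₀ (Real.exp_pos _).le (Real.exp_le_one_iff.2 (by linarith))
  have hcol : ∀ r : ℕ, 1 ≤ r → r ≤ b →
      Real.exp (-(Real.exp (-t) ^ r * (H / r : ℝ))) ≤ Real.exp (-(Real.exp t / b)) := by
    intro r hr hrb
    have hr0 : (0 : ℝ) < r := by exact_mod_cast hr
    have hrb' : (r : ℝ) ≤ b := by exact_mod_cast hrb
    refine Real.exp_le_exp.2 (neg_le_neg ?_)
    have h1 : Real.exp t ≤ Real.exp (-t) ^ r * H := by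
      rw [exp_neg_pow]
      refine le_trans ?_ (mul_le_mul_of_nonneg_left hH1 (Real.exp_pos _).le)
      rw [← Real.exp_add]
      exact Real.exp_le_exp.2 (by nlinarith)
    calc Real.exp t / b ≤ Real.exp t / r := by gcongr
      _ ≤ Real.exp (-t) ^ r * H / r := by gcongr
      _ = Real.exp (-t) ^ r * (H / r : ℝ) := by ring
  have hsum : ∀ r : ℕ, 1 ≤ r → r ≤ b →
      ∑ n ∈ Finset.Ico H M, (1 - Real.exp (-t) ^ r) ^ (n / r) ≤
      2 * Real.exp 1 * b * (Real.exp (b * t) * Real.exp (-(Real.exp t / b))) := by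
    intro r hr hrb
    have hrb' : (r : ℝ) ≤ b := by exact_mod_cast hrb
    refine (sum_Ico_one_sub_pow_div_le (by positivity) (hp r) hr H M).trans ?_
    have h1 : (r : ℝ) / Real.exp (-t) ^ r ≤ b * Real.exp (b * t) := by
      rw [exp_neg_pow, Real.exp_neg, div_inv_eq_mul]
      gcongr
    calc 2 * Real.exp 1 * (r / Real.exp (-t) ^ r) * Real.exp (-(Real.exp (-t) ^ r * (H / r : ℝ)))
        ≤ 2 * Real.exp 1 * (b * Real.exp (b * t)) * Real.exp (-(Real.exp t / b)) := by
          refine mul_le_mul (by gcongr) (hcol r hr hrb) (Real.exp_pos _).le (by positivity)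
      _ = _ := by ring
  refine add_le_add (add_le_add ?_ ?_) ?_
  · have h1 := one_sub_pow_div_le (n := ⌈(a * (b + 2) : ℝ) * Real.exp (a * t) * t⌉₊)
      (by positivity) (hp a) ha
    -- The factor a(b+2) in the width makes a row fail with probability O(p^(b+2)), so that the
    -- O(p^(-b-1)) rows fail with total probability O(p).
    have h2 : Real.exp (-(Real.exp (-t) ^ a *
        ((⌈(a * (b + 2) : ℝ) * Real.exp (a * t) * t⌉₊ : ℝ) / a))) ≤
        Real.exp (-((b + 2) * t)) := by
      refine Real.exp_le_exp.2 (neg_le_neg ?_)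
      have h3 := Nat.le_ceil ((a * (b + 2) : ℝ) * Real.exp (a * t) * t)
      have hZ : Real.exp (-t) ^ a * Real.exp (a * t) = 1 := by
        rw [exp_neg_pow, ← Real.exp_add]; simp
      calc (b + 2) * t = Real.exp (-t) ^ a * Real.exp (a * t) * ((b + 2) * t) := by
            rw [hZ, one_mul]
        _ = Real.exp (-t) ^ a * ((a * (b + 2) : ℝ) * Real.exp (a * t) * t / a) := by
            field_simp
        _ ≤ _ := by gcongr
    calc (H : ℝ) * (1 - Real.exp (-t) ^ a) ^ (⌈(a * (b + 2) : ℝ) * Real.exp (a * t) * t⌉₊ / a)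
        ≤ 2 * Real.exp ((b + 1) * t) * (Real.exp 1 * Real.exp (-((b + 2) * t))) := by
          refine mul_le_mul hH2 (h1.trans (by gcongr)) ?_ (by positivity)
          exact pow_nonneg (sub_nonneg.2 (hp a)) _
      _ = 2 * Real.exp 1 * (Real.exp ((b + 1) * t) * Real.exp (-((b + 2) * t))) := by ring
      _ = 2 * Real.exp 1 * Real.exp (-t) := by rw [← Real.exp_add]; ring_nf
  · have h1 := one_sub_pow_div_le (n := H) (by positivity) (hp b) hb1
    calc (H : ℝ) * (1 - Real.exp (-t) ^ b) ^ (H / b)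
        ≤ 2 * Real.exp ((b + 1) * t) * (Real.exp 1 * Real.exp (-(Real.exp t / b))) := by
          refine mul_le_mul hH2 (h1.trans ?_) ?_ (by positivity)
          · exact mul_le_mul_of_nonneg_left (hcol b hb1 le_rfl) (Real.exp_pos 1).le
          · exact pow_nonneg (sub_nonneg.2 (hp b)) _
      _ = _ := by ring
  · have h1 := hsum b hb1 le_rfl
    have h2 := hsum a ha hab.le
    linarith

/-- With `z` = √(L+1) there are O(z³) segments of length about `z`, and the success rate `q` of a
block is at least z^(-1/2). So failures are exponentially small in √z; the seventh Taylor term of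
the exponential beats z³ = (√z)^6 by one power. -/
theorem lines_bound {b : ℕ} (hb : 1 ≤ b) {z q : ℝ} {M r : ℕ} (hr : 1 ≤ r) (hrb : r ≤ b)
    (hz : 1 ≤ z) (hM : z / 2 ≤ M) (hq : 1 / √z ≤ q) (hq1 : q ≤ 1) :
    z ^ 3 * (1 - q) ^ (M / r) ≤ Real.exp 1 * (5040 * (2 * b) ^ 7) / √z := by
  have hb0 : (0 : ℝ) < b := by exact_mod_cast hb
  have hr0 : (0 : ℝ) < r := by exact_mod_cast hr
  have hrb' : (r : ℝ) ≤ b := by exact_mod_cast hrb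
  have hy : 1 ≤ √z := Real.one_le_sqrt.2 hz
  have hyz : √z ^ 2 = z := Real.sq_sqrt (by linarith)
  obtain ⟨y, hy_def⟩ : ∃ y, y = √z := ⟨_, rfl⟩
  rw [← hy_def] at hy hyz hq ⊢
  have hq0 : 0 < q := lt_of_lt_of_le (by positivity) hq
  have h1 := one_sub_pow_div_le hq0.le hq1 (n := M) hr
  have h2 : Real.exp (-(q * (M / r : ℝ))) ≤ Real.exp (-(y / (2 * b))) := by
    refine Real.exp_le_exp.2 (neg_le_neg ?_)
    calc y / (2 * b) = 1 / y * (y ^ 2 / 2 / b) := by field_simp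
      _ ≤ q * (M / r : ℝ) := by
          rw [hyz]
          gcongr
  have h3 := Real.pow_div_factorial_le_exp (y / (2 * b)) (by positivity) 7
  have h4 : ((Nat.factorial 7 : ℕ) : ℝ) = 5040 := by norm_num [Nat.factorial]
  rw [h4, div_pow, div_div] at h3
  have h5 : Real.exp (-(y / (2 * b))) ≤ (2 * b) ^ 7 * 5040 / y ^ 7 := by
    rw [Real.exp_neg, inv_le_comm₀ (Real.exp_pos _) (by positivity), inv_div]
    exact h3
  calc z ^ 3 * (1 - q) ^ (M / r) ≤ z ^ 3 * (Real.exp 1 * ((2 * b) ^ 7 * 5040 / y ^ 7)) := by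
        gcongr
        exact h1.trans (by gcongr; exact h2.trans h5)
    _ = _ := by
        rw [← hyz]
        field_simp

theorem le_width_and_width_le (ha : 1 ≤ a) (hab : a < b) {t : ℝ}
    (ht : (a * (b + 2) + 1 : ℝ) ≤ t) :
    a ≤ ⌈(a * (b + 2) : ℝ) * Real.exp (a * t) * t⌉₊ ∧
      ⌈(a * (b + 2) : ℝ) * Real.exp (a * t) * t⌉₊ ≤ ⌈Real.exp ((b + 1) * t)⌉₊ := by
  have ha' : (1 : ℝ) ≤ a := by exact_mod_cast ha
  have hb' : (a : ℝ) + 1 ≤ b := by exact_mod_cast hab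
  have hat : (a : ℝ) ≤ t := by nlinarith
  have ht0 : 0 < t := by linarith
  have hZ1 : 1 ≤ Real.exp (a * t) := Real.one_le_exp (by positivity)
  constructor
  · have h1 : (1 : ℝ) * 1 * a ≤ (a * (b + 2) : ℝ) * Real.exp (a * t) * t := by
      gcongr
      nlinarith
    have h2 : (a : ℝ) ≤ (⌈(a * (b + 2) : ℝ) * Real.exp (a * t) * t⌉₊ : ℕ) := by
      rw [one_mul, one_mul] at h1
      exact h1.trans (Nat.le_ceil _)
    exact_mod_cast h2
  · refine Nat.ceil_le_ceil ?_
    have h1 : Real.exp ((b + 1) * t) = Real.exp (a * t) * Real.exp ((b + 1 - a) * t) := by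
      rw [← Real.exp_add]; ring_nf
    rw [h1, show (a * (b + 2) : ℝ) * Real.exp (a * t) * t =
      Real.exp (a * t) * ((a * (b + 2)) * t) by ring]
    refine mul_le_mul_of_nonneg_left ?_ (by linarith)
    have h2 : Real.exp (2 * t) ≤ Real.exp ((b + 1 - a) * t) :=
      Real.exp_le_exp.2 (mul_le_mul_of_nonneg_right (by linarith) ht0.le)
    refine le_trans ?_ h2
    have h3 := Real.pow_div_factorial_le_exp (2 * t) (by positivity) 2
    have h4 : ((Nat.factorial 2 : ℕ) : ℝ) = 2 := by norm_num [Nat.factorial]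
    rw [h4] at h3
    have h5 : (a * (b + 2) : ℝ) * t ≤ t * t := mul_le_mul_of_nonneg_right (by linarith) ht0.le
    nlinarith

/-- The seed costs at most exp((Γ+1) Z t²), where the extra 1 absorbs the rounding of `w`, and the
number of boxes exceeds it by a further factor exp(Z t²), up to constants. -/
theorem seed_bound {Γ Z t : ℝ} {M w : ℕ} (hΓ : Γ = a * b * (b + 2))
    (ht : (b : ℝ) ≤ t) (hZ1 : 1 ≤ Z) (hw2 : (w : ℝ) ≤ (a * (b + 2) : ℝ) * Z * t + 1)
    (h2 : Real.exp ((Γ + 2) * (Z * t ^ 2)) / 2 ≤ M) :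
    (1 - Real.exp (-t) ^ (w * b) * (1 - 1 / 2)) ^ M ≤ Real.exp (-(Real.exp (t ^ 2) / 4)) := by
  have ht0 : 0 ≤ t := (Nat.cast_nonneg b).trans ht
  have hp0 : 0 ≤ Real.exp (-t) := (Real.exp_pos _).le
  have hp1 : Real.exp (-t) ≤ 1 := Real.exp_le_one_iff.2 (by linarith)
  have hZt : t ^ 2 ≤ Z * t ^ 2 := le_mul_of_one_le_left (sq_nonneg t) hZ1
  refine (one_sub_pow_le_exp ?_ M).trans (Real.exp_le_exp.2 (neg_le_neg ?_))
  · have : Real.exp (-t) ^ (w * b) ≤ 1 := pow_le_one₀ hp0 hp1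
    linarith
  · have h1 : Real.exp (-((Γ + 1) * (Z * t ^ 2))) ≤ Real.exp (-t) ^ (w * b) := by
      rw [exp_neg_pow]
      refine Real.exp_le_exp.2 (neg_le_neg ?_)
      push_cast
      have h2 : (w : ℝ) * b * t ≤ ((a * (b + 2) : ℝ) * Z * t + 1) * b * t := by gcongr
      have h3 : ((a * (b + 2) : ℝ) * Z * t + 1) * b * t = Γ * (Z * t ^ 2) + b * t := by
        rw [hΓ]; ring
      have h4 : b * t ≤ t ^ 2 := by
        rw [sq]; exact mul_le_mul_of_nonneg_right ht ht0
      linarith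
    calc Real.exp (t ^ 2) / 4 ≤ Real.exp (Z * t ^ 2) / 4 := by gcongr
      _ = Real.exp (-((Γ + 1) * (Z * t ^ 2))) * (1 - 1 / 2) *
          (Real.exp ((Γ + 2) * (Z * t ^ 2)) / 2) := by
          rw [show Z * t ^ 2 = -((Γ + 1) * (Z * t ^ 2)) + (Γ + 2) * (Z * t ^ 2) by ring,
            Real.exp_add]
          ring_nf
      _ ≤ _ := by
          refine mul_le_mul (mul_le_mul_of_nonneg_right h1 (by norm_num)) h2 (by positivity) ?_
          exact mul_nonneg (by positivity) (by norm_num)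

/-- Above the critical scale, the probability of internal spanning is close to one. -/
theorem exists_supercritical_bound (ha : 1 ≤ a) (hab : a < b) : ∃ Γ₀ : ℝ, ∃ B : ℝ → ℝ,
    Tendsto B atTop (𝓝 0) ∧ ∀ᶠ t : ℝ in atTop, ∀ L : ℕ,
      Real.exp (Γ₀ * Real.exp (a * t) * t ^ 2) < L →
      1 - B t ≤
        bprob (Real.exp (-t)) (sites L) {S | square L ⊆ finalConfig a b (square L) S} := by
  have ha' : (1 : ℝ) ≤ a := by exact_mod_cast ha
  have hb' : (a : ℝ) + 1 ≤ b := by exact_mod_cast hab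
  have hb0 : (0 : ℝ) < b := by linarith
  have hb1 : 1 ≤ b := by omega
  obtain ⟨Γ, hΓ⟩ : ∃ Γ : ℝ, Γ = a * b * (b + 2) := ⟨_, rfl⟩
  have hΓ0 : 0 ≤ Γ := by rw [hΓ]; positivity
  obtain ⟨K, hK⟩ : ∃ K : ℝ, K = Real.exp 1 * (5040 * (2 * b) ^ 7) := ⟨_, rfl⟩
  have hK0 : 0 ≤ K := by rw [hK]; positivity
  -- The factor 2 is there because the number of boxes is only about the square root of `L`.
  refine ⟨2 * (Γ + 2), fun t => Real.exp (-(Real.exp (t ^ 2) / 4)) +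
    2 * K * Real.exp (-(1 / 2 * t ^ 2) + 0 * t + 0), ?_, ?_⟩
  · have h1 : Tendsto (fun t : ℝ => Real.exp (-(Real.exp (t ^ 2) / 4))) atTop (𝓝 0) := by
      refine Real.tendsto_exp_neg_atTop_nhds_zero.comp
        (Tendsto.atTop_div_const (by norm_num) (Real.tendsto_exp_atTop.comp ?_))
      exact tendsto_pow_atTop two_ne_zero
    simpa using h1.add (tendsto_exp_neg_mul_sq_add (2 * K) (by norm_num : (0 : ℝ) < 1 / 2) 0 0)
  · filter_upwards [eventually_growth_bound ha hab, eventually_ge_atTop (b + 3 : ℝ),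
      eventually_ge_atTop (2 * b : ℝ), eventually_ge_atTop (a * (b + 2) + 1 : ℝ)]
      with t hgrow ht1 ht2 ht3 L hL
    have ht0 : 0 < t := by linarith
    have hp0 : 0 ≤ Real.exp (-t) := (Real.exp_pos _).le
    have hp1 : Real.exp (-t) ≤ 1 := Real.exp_le_one_iff.2 (by linarith)
    have hZ1 : 1 ≤ Real.exp (a * t) := Real.one_le_exp (by positivity)
    obtain ⟨Z, hZ⟩ : ∃ Z, Z = Real.exp (a * t) := ⟨_, rfl⟩
    rw [← hZ] at hL hZ1 hgrow
    obtain ⟨z, hz⟩ : ∃ z, z = √((L : ℝ) + 1) := ⟨_, rfl⟩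
    have hz2 : z ^ 2 = L + 1 := by rw [hz]; exact Real.sq_sqrt (by positivity)
    have hz0 : 0 ≤ z := by rw [hz]; positivity
    have hzZ : Real.exp ((Γ + 2) * (Z * t ^ 2)) ≤ z := by
      refine le_of_sq_le_sq ?_ hz0
      rw [hz2, ← Real.exp_nat_mul]
      push_cast
      rw [show 2 * ((Γ + 2) * (Z * t ^ 2)) = 2 * (Γ + 2) * Z * t ^ 2 by ring]
      linarith
    have hZt : t ^ 2 ≤ Z * t ^ 2 := by nlinarith [sq_nonneg t]
    have hzt : Real.exp (t ^ 2) ≤ z :=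
      (Real.exp_le_exp.2 (by nlinarith [sq_nonneg t])).trans hzZ
    have hz4 : 4 * Real.exp ((b + 1) * t) ≤ z := by
      refine le_trans ?_ hzt
      have h1 : Real.exp (t ^ 2) = Real.exp (t ^ 2 - (b + 1) * t) * Real.exp ((b + 1) * t) := by
        rw [← Real.exp_add]; ring_nf
      rw [h1]
      refine mul_le_mul_of_nonneg_right ?_ (Real.exp_pos _).le
      have := Real.add_one_le_exp (t ^ 2 - (b + 1) * t)
      nlinarith
    have hone : 1 ≤ Real.exp ((b + 1) * t) := Real.one_le_exp (by positivity)
    set M := Nat.sqrt (L + 1) with hM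
    have hM1 : M * M ≤ L + 1 := Nat.sqrt_le _
    have hMz : (M : ℝ) ≤ z := by
      refine le_of_sq_le_sq ?_ hz0
      rw [hz2, sq]
      exact_mod_cast hM1
    have hzM : z / 2 ≤ M := by
      have h1 : L + 1 < (M + 1) * (M + 1) := Nat.lt_succ_sqrt (L + 1)
      have h2 : z ≤ M + 1 := by
        refine le_of_sq_le_sq ?_ (by positivity)
        rw [hz2, sq]
        exact_mod_cast h1.le
      linarith
    set H := ⌈Real.exp ((b + 1) * t)⌉₊ with hH
    have hH2 : (H : ℝ) ≤ 2 * Real.exp ((b + 1) * t) := by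
      have := (Nat.ceil_lt_add_one (Real.exp_pos ((b + 1) * t)).le).le
      linarith
    have hHM : H ≤ M := by
      have : (H : ℝ) ≤ M := by linarith
      exact_mod_cast this
    have hbH : b ≤ H := by
      have h1 := Nat.le_ceil (Real.exp ((b + 1) * t))
      have h2 := Real.add_one_le_exp ((b + 1) * t)
      have : (b : ℝ) ≤ H := by nlinarith
      exact_mod_cast this
    set w := ⌈(a * (b + 2) : ℝ) * Z * t⌉₊ with hw
    have hw2 : (w : ℝ) ≤ (a * (b + 2) : ℝ) * Z * t + 1 := (Nat.ceil_lt_add_one (by positivity)).le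
    obtain ⟨haw, hwH⟩ : a ≤ w ∧ w ≤ H := by
      rw [hw, hZ]
      exact le_width_and_width_le ha hab ht3
    have hmain := le_bprob_spanned (a := a) (b := b) hp0 hp1 hM1 haw hwH hbH hHM (hgrow M)
    refine le_trans ?_ hmain
    have hseed := seed_bound hΓ (by linarith : (b : ℝ) ≤ t) hZ1 hw2
      ((div_le_div_of_nonneg_right hzZ zero_le_two).trans hzM)
    have hz1 : 1 ≤ z := by linarith
    have hsz : Real.exp (1 / 2 * t ^ 2) ≤ √z := by
      refine Real.le_sqrt_of_sq_le ?_
      rw [← Real.exp_nat_mul]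
      refine le_trans (le_of_eq ?_) hzt
      push_cast
      ring_nf
    have hsz0 : 0 < √z := Real.sqrt_pos.2 (by linarith)
    have hline : ∀ r : ℕ, 1 ≤ r → r ≤ b → z ^ 3 * (1 - Real.exp (-t) ^ r) ^ (M / r) ≤
        K * Real.exp (-(1 / 2 * t ^ 2) + 0 * t + 0) := by
      intro r hr hrb
      have hrb' : (r : ℝ) ≤ b := by exact_mod_cast hrb
      refine (lines_bound hb1 hr hrb hz1 hzM ?_ (pow_le_one₀ hp0 hp1)).trans ?_
      · rw [exp_neg_pow, Real.exp_neg, one_div]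
        refine inv_anti₀ (Real.exp_pos _) (le_trans (Real.exp_le_exp.2 ?_) hsz)
        nlinarith
      · rw [← hK, div_eq_mul_inv]
        refine mul_le_mul_of_nonneg_left ?_ hK0
        rw [zero_mul, add_zero, add_zero, Real.exp_neg]
        exact inv_anti₀ (Real.exp_pos _) hsz
    have hla := hline a ha hab.le
    have hlb := hline b hb1 le_rfl
    have hq0 : ∀ r : ℕ, 0 ≤ (1 - Real.exp (-t) ^ r) ^ (M / r) := fun r =>
      pow_nonneg (sub_nonneg.2 (pow_le_one₀ hp0 hp1)) _
    have hl1 : (M : ℝ) * (L + 1) * (1 - Real.exp (-t) ^ a) ^ (M / a) ≤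
        z ^ 3 * (1 - Real.exp (-t) ^ a) ^ (M / a) := by
      refine mul_le_mul_of_nonneg_right ?_ (hq0 a)
      rw [← hz2, show z ^ 3 = z * z ^ 2 by ring]
      gcongr
    have hl2 : ((L : ℝ) + 1) * (1 - Real.exp (-t) ^ b) ^ (M / b) ≤
        z ^ 3 * (1 - Real.exp (-t) ^ b) ^ (M / b) := by
      refine mul_le_mul_of_nonneg_right ?_ (hq0 b)
      rw [← hz2]
      exact pow_le_pow_right₀ hz1 (by norm_num)
    linarith

theorem tendsto_neg_log_coe :
    Tendsto (fun p : unitInterval => -Real.log (p : ℝ)) (𝓝[>] (0 : unitInterval)) atTop := by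
  refine tendsto_neg_atBot_atTop.comp (Real.tendsto_log_nhdsGT_zero.comp ?_)
  refine tendsto_nhdsWithin_iff.2 ⟨?_, ?_⟩
  · exact (continuous_subtype_val.tendsto (0 : unitInterval)).mono_left nhdsWithin_le_nhds
  · filter_upwards [self_mem_nhdsWithin] with p hp
    exact hp

end Asymptotics

end AnisotropicBootstrap

open AnisotropicBootstrap in
theorem claim1 (a b : ℕ) (ha : 1 ≤ a) (hab : a < b) :
    ∃ γ Γ : ℝ, 0 < γ ∧ γ < Γ ∧
      (∀ L : unitInterval → ℕ,
        (∀ᶠ p : unitInterval in 𝓝[>] (0 : unitInterval),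
          (L p : ℝ) < Real.exp (γ * ((p : ℝ) ^ a)⁻¹ * Real.log (p : ℝ) ^ 2)) →
        Tendsto (fun p : unitInterval => AnisotropicBootstrap.spanProb a b (L p) p)
          (𝓝[>] (0 : unitInterval)) (𝓝 0)) ∧
      (∀ L : unitInterval → ℕ,
        (∀ᶠ p : unitInterval in 𝓝[>] (0 : unitInterval),
          Real.exp (Γ * ((p : ℝ) ^ a)⁻¹ * Real.log (p : ℝ) ^ 2) < (L p : ℝ)) →
        Tendsto (fun p : unitInterval => AnisotropicBootstrap.spanProb a b (L p) p)
          (𝓝[>] (0 : unitInterval)) (𝓝 1)) := by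
  obtain ⟨γ, hγ, B, hB, hlow⟩ := exists_subcritical_bound ha hab
  obtain ⟨Γ₀, B', hB', hup⟩ := exists_supercritical_bound ha hab
  have hexp : ∀ p : unitInterval, 0 < p →
      Real.exp (-(-Real.log (p : ℝ))) = p ∧
      Real.exp (a * -Real.log (p : ℝ)) = ((p : ℝ) ^ a)⁻¹ := by
    intro p hp
    have hp' : (0 : ℝ) < p := hp
    refine ⟨by rw [neg_neg, Real.exp_log hp'], ?_⟩
    rw [mul_neg, Real.exp_neg, Real.exp_nat_mul, Real.exp_log hp']
  -- A larger upper constant only strengthens the assumption on `L`, so the maximum secures γ < Γ at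
  -- no cost.
  refine ⟨γ, max Γ₀ (γ + 1), hγ, lt_of_lt_of_le (lt_add_one γ) (le_max_right _ _),
    fun L hL => ?_, fun L hL => ?_⟩
  · refine tendsto_of_tendsto_of_tendsto_of_le_of_le' tendsto_const_nhds
      (hB.comp tendsto_neg_log_coe) (Eventually.of_forall fun p => measureReal_nonneg) ?_
    filter_upwards [hL, tendsto_neg_log_coe.eventually hlow, self_mem_nhdsWithin] with p h1 h2 hp
    have h3 := h2 (L p)
    rw [(hexp p hp).1, (hexp p hp).2, neg_sq, ← spanProb_eq_bprob] at h3
    exact h3 h1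
  · have h1B : Tendsto (fun p : unitInterval => 1 - B' (-Real.log (p : ℝ)))
        (𝓝[>] (0 : unitInterval)) (𝓝 1) := by
      simpa using (hB'.comp tendsto_neg_log_coe).const_sub 1
    refine tendsto_of_tendsto_of_tendsto_of_le_of_le' h1B tendsto_const_nhds ?_
      (Eventually.of_forall fun p => measureReal_le_one)
    filter_upwards [hL, tendsto_neg_log_coe.eventually hup, self_mem_nhdsWithin] with p h1 h2 hp
    have h3 := h2 (L p)
    rw [(hexp p hp).1, (hexp p hp).2, neg_sq, ← spanProb_eq_bprob] at h3
    refine h3 (lt_of_le_of_lt (Real.exp_le_exp.2 ?_) h1)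
    have hp' : (0 : ℝ) < p := hp
    gcongr
    exact le_max_left _ _
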